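/- \textbf{Setting.} Consider $x_{k+1}=Ax_k+Bu_k+Dw_k$ with $x_k\in\mathbb R^n$, $u_k\in\mathbb R^m$, $w_k\in\mathbb R^q$. The $w_k$ are i.i.d., $\mathbb E\{w_k\}=0$, $w_k\in\mathbb W$ almost surely, where $\mathbb W$ is bounded with $0\in\operatorname{int}\mathbb W$, and $\mathbb P\{\|w_k\|\le\lambda\}>0$ for all $\lambda>0$. Let $Q,R,P\succ0$ with $P=Q+A^\top PA-K^\top(R+B^\top PB)K$, $K=-(R+B^\top PB)^{-1}B^\top PA$, and put $\Phi=A+BK$, $S=Q+K^\top RK$. The constraints are $(x_k,u_k)\in\mathbb Z$, where $\mathbb Z$ is a compact polyhedron with $0\in\operatorname{int}\mathbb Z$, and $\mathbb P\{f_j^\top x_{k+1}+g_j^\top u_k\le h_j\}\ge p_j$ with $p_j\in(0,1]$, $j=1,\dots,n_c$. Let $\gamma_j$ be such that $f_j^\top(Ax+Bu)+g_j^\top u+\gamma_j\le h_j$ implies $\mathbb P\{f_j^\top(Ax+Bu+Dw_0)+g_j^\top u\le h_j\}\ge p_j$, and let $\mathbb S$ be the set of all $(x,u)$ with $f_j^\top(Ax+Bu)+g_j^\top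 u+\gamma_j\le h_j$ for all $j$. Let $N\ge1$, let $L_1,\dots,L_{N-1}$ be disturbance feedback gains, and for ${\bf c}=(c_0,\dots,c_{N-1})$ (with $c_i=0$ for $i\ge N$) let the predictions from $x$ be $$x_{0|}=x,\qquad u_{i|}=Kx_{i|}+c_i+\sum_{j=1}^{\min(i,N-1)}L_jw_{i-j|},\qquad x_{i+1|}=Ax_{i|}+Bu_{i|}+Dw_{i|}.$$ The nominal predictions $(\bar x_i,\bar u_i)$ are those with all $w_{i|}=0$, and $(e_i,v_i)$ is the uncertain component, i.e. the prediction with $x=0$, ${\bf c}=0$. Let $\tilde{\mathbb Z}_i$ (resp. $\tilde{\mathbb S}_i$) be the set of $z$ such that $z+(e_i,v_i)\in\mathbb Z$ (resp. $\mathbb S$) for all disturbance sequences in $\mathbb W$. The MPC problem at $x$ is to minimize $$x^\top Px+\sum_{i=0}^{N-1}c_i^\top(R+B^\top PB)c_i\quad\text{subject to}\quad(\bar x_i,\bar u_i)\in\tilde{\mathbb S}_i\cap\tilde{\mathbb Z}_i,\quad i=0,\dots,N+N_2-1,$$ where $N_2$ is large enough that these constraints imply $(\bar x_i,\bar u_i)\in\tilde{\mathbb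 S}_i\cap\tilde{\mathbb Z}_i$ for all $i\ge N$. Let $\mathbb X$ be the set of $x$ at which it is feasible, ${\bf c}^*(x)$ its solution, $\mathbb X_{uc}=\{x\in\mathbb X: c_0^*(x)=0\}$, and let the closed loop be $$x_{k+1}=\Phi x_k+Bc_0^*(x_k)+Dw_k.$$ Let $\mathbb X_\infty$ be the minimal robustly positively invariant (RPI) set of the closed loop, i.e. the intersection of all $X$ with $0\in X\subseteq\mathbb X$ and $\Phi x+Bc_0^*(x)+Dw\in X$ for all $(x,w)\in X\times\mathbb W$. \textbf{Claim.} Assume that $\mathbb X_\infty\subseteq\mathbb X_{uc}$ and that $(\Phi,D)$ is controllable. Then for every $x_0\in\mathbb X$ the closed loop satisfies $$\mathbb P\Bigl\{\lim_{k\to\infty}{\bf 1}_{\mathbb X_\infty}(x_k)=1\Bigr\}=1,$$ and, with $l_{ss}=\mathbb E\{w^\top D^\top PDw\}$, where $P$ satisfies $P-\Phi^\top P\Phi=S$, all $x_j^\top Sx_j$ are integrable, the following limit exists, and $$\lim_{k\to\infty}\frac1k\sum_{j=0}^{k-1}\mathbb E\{x_j^\top Sx_j\}\le l_{ss}.$$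 Moreover, $l_{ss}$ is the limit average of the same cost for the unconstrained optimal law: for every $y_0\in\mathbb R^n$, the system $y_{k+1}=\Phi y_k+Dw_k$ satisfies $\lim_{k\to\infty}\frac1k\sum_{j=0}^{k-1}\mathbb E\{y_j^\top Sy_j\}=l_{ss}$. -/

import Mathlib

open MeasureTheory ProbabilityTheory Filter Topology
open scoped Matrix

/-- A set is a polyhedron if it is the solution set of finitely many affine inequalities. -/
def IsPolyhedron {E : Type*} [AddCommGroup E] [Module ℝ E] (Z : Set E) : Prop :=
  ∃ (r : ℕ) (a : Fin r → E →ₗ[ℝ] ℝ) (b : Fin r → ℝ), Z = {z | ∀ i, a i z ≤ b i}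

/-- `Y` is robustly positively invariant for `x⁺ = f x w`, `w ∈ W`. -/
def IsRPI {E F : Type*} (f : E → F → E) (W : Set F) (Y : Set E) : Prop :=
  ∀ x ∈ Y, ∀ w ∈ W, f x w ∈ Y

/-- The minimal RPI set of `x⁺ = f x w` in the state set `X`: the intersection of all RPI sets
`Y` with `0 ∈ Y ⊆ X`. -/
def minimalRPI {E F : Type*} [Zero E] (X : Set E) (W : Set F) (f : E → F → E) : Set E :=
  ⋂₀ {Y | (0 : E) ∈ Y ∧ Y ⊆ X ∧ IsRPI f W Y}

/-- `(Φ, D)` is controllable: the columns of `D, Φ D, …, Φ ^ (n - 1) D` span the state space. -/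
def IsControllablePair {n q : ℕ} (Φ : Matrix (Fin n) (Fin n) ℝ) (D : Matrix (Fin n) (Fin q) ℝ) :
    Prop :=
  (⨆ j : Fin n, LinearMap.range (Matrix.toLin' (Φ ^ (j : ℕ) * D))) = ⊤

/-- The data of a striped stochastic MPC problem with `n` states, `m` inputs, `q` disturbance
components and `nc` probabilistic constraints. No property of the data is part of the structure. -/
structure StripedMPC (n m q nc : ℕ) where
  /-- dynamics `x⁺ = A x + B u + D w` -/
  A : Matrix (Fin n) (Fin n) ℝ
  B : Matrix (Fin n) (Fin m) ℝ
  D : Matrix (Fin n) (Fin q) ℝ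
  /-- state weight -/
  Q : Matrix (Fin n) (Fin n) ℝ
  /-- input weight -/
  R : Matrix (Fin m) (Fin m) ℝ
  /-- the matrix of the Riccati equation -/
  P : Matrix (Fin n) (Fin n) ℝ
  /-- number of free input perturbations -/
  N : ℕ
  /-- number of further steps at which constraints are imposed -/
  N₂ : ℕ
  /-- striped disturbance feedback gains; only `L 1, …, L (N - 1)` are used -/
  L : ℕ → Matrix (Fin m) (Fin q) ℝ
  /-- disturbance set -/
  W : Set (Fin q → ℝ)
  /-- hard constraint set -/
  Z : Set ((Fin n → ℝ) × (Fin m → ℝ))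
  /-- probabilistic constraints `ℙ {f j ⬝ x⁺ + g j ⬝ u ≤ h j} ≥ p j` -/
  f : Fin nc → Fin n → ℝ
  g : Fin nc → Fin m → ℝ
  h : Fin nc → ℝ
  p : Fin nc → ℝ
  /-- tightening parameters of the probabilistic constraints -/
  γ : Fin nc → ℝ

namespace StripedMPC

variable {n m q nc : ℕ} (M : StripedMPC n m q nc)

/-- `K = -(R + Bᵀ P B)⁻¹ Bᵀ P A`. -/
noncomputable def K : Matrix (Fin m) (Fin n) ℝ :=
  -((M.R + M.Bᵀ * M.P * M.B)⁻¹ * M.Bᵀ * M.P * M.A)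

/-- `Φ = A + B K`. -/
noncomputable def Φ : Matrix (Fin n) (Fin n) ℝ := M.A + M.B * M.K

/-- `S = Q + Kᵀ R K`. -/
noncomputable def S : Matrix (Fin n) (Fin n) ℝ := M.Q + M.Kᵀ * M.R * M.K

/-- `P = Q + Aᵀ P A - Kᵀ (R + Bᵀ P B) K`. -/
def SolvesRiccati : Prop :=
  M.P = M.Q + M.Aᵀ * M.P * M.A - M.Kᵀ * (M.R + M.Bᵀ * M.P * M.B) * M.K

/-- The `i`-th input perturbation of `c = (c 0, …, c (N - 1))`, which is zero for `i ≥ N`. -/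
def perturbation (c : Fin M.N → Fin m → ℝ) (i : ℕ) : Fin m → ℝ :=
  if hi : i < M.N then c ⟨i, hi⟩ else 0

/-- The striped predicted control policy
`u i = K x i + c i + ∑ j = 1 … min i (N - 1), L j w (i - j)`, as a function of the predicted
state `x` at step `i`. -/
noncomputable def policy (c : Fin M.N → Fin m → ℝ) (w : ℕ → Fin q → ℝ) (i : ℕ)
    (x : Fin n → ℝ) : Fin m → ℝ :=
  M.K *ᵥ x + M.perturbation c i + ∑ j ∈ Finset.Icc 1 (min i (M.N - 1)), M.L j *ᵥ w (i - j)

/-- The predicted states from `x` under the striped policy and the disturbances `w`. -/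
noncomputable def predState (x : Fin n → ℝ) (c : Fin M.N → Fin m → ℝ) (w : ℕ → Fin q → ℝ) :
    ℕ → Fin n → ℝ
  | 0 => x
  | i + 1 => M.A *ᵥ predState x c w i + M.B *ᵥ M.policy c w i (predState x c w i) + M.D *ᵥ w i

/-- The predicted state-input pairs. -/
noncomputable def predPair (x : Fin n → ℝ) (c : Fin M.N → Fin m → ℝ) (w : ℕ → Fin q → ℝ)
    (i : ℕ) : (Fin n → ℝ) × (Fin m → ℝ) :=
  (M.predState x c w i, M.policy c w i (M.predState x c w i))

/-- The nominal predictions, which assume zero disturbances: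
`x̄ 0 = x`, `ū i = K x̄ i + c i`, `x̄ (i + 1) = A x̄ i + B ū i`. -/
noncomputable def nominalPair (x : Fin n → ℝ) (c : Fin M.N → Fin m → ℝ) (i : ℕ) :
    (Fin n → ℝ) × (Fin m → ℝ) :=
  M.predPair x c 0 i

/-- The uncertain component of the predicted state-input pair at step `i`. By linearity, the
predicted pair is the sum of the nominal pair and of this one. -/
noncomputable def uncertainPair (w : ℕ → Fin q → ℝ) (i : ℕ) : (Fin n → ℝ) × (Fin m → ℝ) :=
  M.predPair 0 0 w i

/-- The set of state-input pairs that satisfy the tightened probabilistic constraints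
`f jᵀ (A x + B u) + g jᵀ u + γ j ≤ h j`. -/
def probSet : Set ((Fin n → ℝ) × (Fin m → ℝ)) :=
  {z | ∀ j, M.f j ⬝ᵥ (M.A *ᵥ z.1 + M.B *ᵥ z.2) + M.g j ⬝ᵥ z.2 + M.γ j ≤ M.h j}

/-- The constraint set `T` tightened for the worst case of the uncertain component of the
predictions at step `i`. -/
def tightened (T : Set ((Fin n → ℝ) × (Fin m → ℝ))) (i : ℕ) :
    Set ((Fin n → ℝ) × (Fin m → ℝ)) :=
  {z | ∀ w : ℕ → Fin q → ℝ, (∀ l, w l ∈ M.W) → z + M.uncertainPair w i ∈ T}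

/-- `c` is feasible for the optimal control problem at the state `x`: the nominal predictions
satisfy the tightened constraints at steps `0, …, N + N₂ - 1`. -/
def Feasible (x : Fin n → ℝ) (c : Fin M.N → Fin m → ℝ) : Prop :=
  ∀ i < M.N + M.N₂, M.nominalPair x c i ∈ M.tightened M.probSet i ∩ M.tightened M.Z i

/-- `N₂` is large enough: the constraints imposed at the steps `0, …, N + N₂ - 1` ensure that the
tightened constraints hold at all steps `i ≥ N`. -/
def HorizonLongEnough : Prop :=
  ∀ x c, M.Feasible x c →
    ∀ i ≥ M.N, M.nominalPair x c i ∈ M.tightened M.probSet i ∩ M.tightened M.Z i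

/-- The cost `V(x, c) = xᵀ P x + cᵀ (I ⊗ (R + Bᵀ P B)) c`. -/
def cost (x : Fin n → ℝ) (c : Fin M.N → Fin m → ℝ) : ℝ :=
  x ⬝ᵥ M.P *ᵥ x + ∑ i, c i ⬝ᵥ (M.R + M.Bᵀ * M.P * M.B) *ᵥ c i

/-- `c` solves the optimal control problem at the state `x`. -/
def IsOptimal (x : Fin n → ℝ) (c : Fin M.N → Fin m → ℝ) : Prop :=
  M.Feasible x c ∧ ∀ c', M.Feasible x c' → M.cost x c ≤ M.cost x c'

/-- The set `𝕏` of states at which the optimal control problem is feasible. -/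
def feasibleStates : Set (Fin n → ℝ) := {x | ∃ c, M.Feasible x c}

open Classical in
/-- The optimal solution `c⋆(x)`; it is set to `0` where there is none. -/
noncomputable def optimizer (x : Fin n → ℝ) : Fin M.N → Fin m → ℝ :=
  if hx : ∃ c, M.IsOptimal x c then hx.choose else 0

/-- The closed-loop dynamics `x⁺ = Φ x + B c⋆₀(x) + D w`. -/
noncomputable def closedLoopMap (x : Fin n → ℝ) (w : Fin q → ℝ) : Fin n → ℝ :=
  M.Φ *ᵥ x + M.B *ᵥ M.perturbation (M.optimizer x) 0 + M.D *ᵥ w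

/-- The closed-loop trajectory from `x₀` under the disturbance sequence `w`. -/
noncomputable def closedLoop (x₀ : Fin n → ℝ) (w : ℕ → Fin q → ℝ) : ℕ → Fin n → ℝ
  | 0 => x₀
  | k + 1 => M.closedLoopMap (closedLoop x₀ w k) (w k)

/-- The trajectory from `y₀` under the unconstrained optimal law `u = K y` and the disturbance
sequence `w`. -/
noncomputable def unconstrainedLoop (y₀ : Fin n → ℝ) (w : ℕ → Fin q → ℝ) : ℕ → Fin n → ℝ
  | 0 => y₀
  | k + 1 => M.Φ *ᵥ unconstrainedLoop y₀ w k + M.D *ᵥ w k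

/-- `𝕏_uc = {x ∈ 𝕏 | c⋆₀(x) = 0}`. -/
def unconstrainedRegion : Set (Fin n → ℝ) :=
  {x | x ∈ M.feasibleStates ∧ M.perturbation (M.optimizer x) 0 = 0}

/-- `𝕏_∞`, the minimal RPI set of the closed-loop system. -/
def minRPI : Set (Fin n → ℝ) := minimalRPI M.feasibleStates M.W M.closedLoopMap

/-- `l_ss = 𝔼 {wᵀ Dᵀ P D w}` for a disturbance `w`. -/
noncomputable def lss {Ω : Type*} [MeasurableSpace Ω] (μ : Measure Ω) (w : Ω → Fin q → ℝ) : ℝ :=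
  ∫ ω, w ω ⬝ᵥ (M.Dᵀ * M.P * M.D) *ᵥ w ω ∂μ

end StripedMPC

/-!
The matrices satisfy the Lyapunov equation `P - Φᵀ P Φ = S`, and completing squares shows that
`xᵀ P x + cᵀ (R + Bᵀ P B) c` is the cost-to-go of the undisturbed system under the plan `c`.

Predictions are consistent in time (`predPair_shiftPlan`): after the first disturbance `w` the
remaining predictions are those of the shifted plan, to which the stripes contribute `L (i + 1) w`.
Hence the feasible states form a robustly positively invariant set (`Feasible.shiftPlan`). The
feasible pairs of states and plans are compact and their fibres convex, so the optimizer exists, is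
unique and is measurable (`measurable_optimizer`).

*Entrance.* On the minimal RPI set the closed loop is `Φ x + D w`, so that set contains all states
reachable from the origin by the linear system, and by controllability it contains a ball around
the origin (`minRPI_mem_nhds`). If disturbances are small, the optimal cost drops by at least a
fixed amount at every state outside this ball (`exists_valueFunction_closedLoopMap_le`), so a run of
small disturbances of a fixed length leads from any feasible state into the minimal RPI set. Such a
run occurs almost surely by the second Borel–Cantelli lemma (`ae_exists_run`), and the state never
leaves the set again.

*Average cost.* The state `x k` is independent of the disturbance `w k`, which has mean zero, so
`𝔼 [x (k+1)ᵀ P x (k+1)] = 𝔼 [x kᵀ P x k] - 𝔼 [x kᵀ S x k] + l_ss + 𝔼 [d (x k)]`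
with a bounded function `d` that vanishes where `c⋆₀ = 0`. Since the state is eventually in the
minimal RPI set, `𝔼 [d (x k)]` tends to zero, and telescoping shows that the averages converge to
`l_ss` itself. For the unconstrained loop `d = 0`, and the second moments are bounded because `S`
dominates a positive multiple of `P`.
-/

/-! ### Quadratic forms -/

theorem mulVec_dotProduct_mulVec_mulVec {a b c d : ℕ} (X : Matrix (Fin c) (Fin a) ℝ)
    (A : Matrix (Fin c) (Fin d) ℝ) (Y : Matrix (Fin d) (Fin b) ℝ) (u : Fin a → ℝ)
    (v : Fin b → ℝ) : (X *ᵥ u) ⬝ᵥ A *ᵥ (Y *ᵥ v) = u ⬝ᵥ (Xᵀ * A * Y) *ᵥ v := by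
  rw [← Matrix.mulVec_mulVec, ← Matrix.mulVec_mulVec, Matrix.dotProduct_mulVec u,
    Matrix.vecMul_transpose]

theorem Matrix.IsSymm.dotProduct_mulVec_comm {a : ℕ} {A : Matrix (Fin a) (Fin a) ℝ}
    (hA : A.IsSymm) (x y : Fin a → ℝ) : x ⬝ᵥ A *ᵥ y = y ⬝ᵥ A *ᵥ x := by
  rw [dotProduct_comm, Matrix.dotProduct_mulVec y, ← Matrix.mulVec_transpose, hA]

theorem Matrix.IsSymm.dotProduct_mulVec_add {a : ℕ} {A : Matrix (Fin a) (Fin a) ℝ}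
    (hA : A.IsSymm) (x y : Fin a → ℝ) :
    (x + y) ⬝ᵥ A *ᵥ (x + y) = x ⬝ᵥ A *ᵥ x + 2 * (x ⬝ᵥ A *ᵥ y) + y ⬝ᵥ A *ᵥ y := by
  rw [Matrix.mulVec_add, add_dotProduct, dotProduct_add, dotProduct_add,
    hA.dotProduct_mulVec_comm y x]
  ring

theorem Matrix.PosDef.isSymm {a : ℕ} {A : Matrix (Fin a) (Fin a) ℝ} (hA : A.PosDef) :
    A.IsSymm := by
  have h := hA.isHermitian
  rwa [Matrix.IsHermitian, Matrix.conjTranspose_eq_transpose_of_trivial] at h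

theorem Matrix.PosDef.quadratic_pos {a : ℕ} {A : Matrix (Fin a) (Fin a) ℝ} (hA : A.PosDef)
    {x : Fin a → ℝ} (hx : x ≠ 0) : 0 < x ⬝ᵥ A *ᵥ x := by
  simpa using hA.dotProduct_mulVec_pos hx

theorem Matrix.PosDef.quadratic_nonneg {a : ℕ} {A : Matrix (Fin a) (Fin a) ℝ} (hA : A.PosDef)
    (x : Fin a → ℝ) : 0 ≤ x ⬝ᵥ A *ᵥ x := by
  simpa using hA.posSemidef.dotProduct_mulVec_nonneg x

@[fun_prop]
theorem continuous_quadratic {a : ℕ} (A : Matrix (Fin a) (Fin a) ℝ) :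
    Continuous fun x : Fin a → ℝ => x ⬝ᵥ A *ᵥ x :=
  continuous_id.dotProduct (Continuous.matrix_mulVec continuous_const continuous_id)

theorem quadratic_smul {a : ℕ} (A : Matrix (Fin a) (Fin a) ℝ) (t : ℝ) (x : Fin a → ℝ) :
    (t • x) ⬝ᵥ A *ᵥ (t • x) = t ^ 2 * (x ⬝ᵥ A *ᵥ x) := by
  rw [Matrix.mulVec_smul, smul_dotProduct, dotProduct_smul, smul_eq_mul, smul_eq_mul]
  ring

theorem exists_quadratic_le {a : ℕ} (A : Matrix (Fin a) (Fin a) ℝ) :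
    ∃ C > 0, ∀ x : Fin a → ℝ, x ⬝ᵥ A *ᵥ x ≤ C * ‖x‖ ^ 2 := by
  obtain ⟨C, hC⟩ := (isCompact_sphere (0 : Fin a → ℝ) 1).exists_bound_of_continuousOn
    (continuous_quadratic A).continuousOn
  refine ⟨max C 1, by positivity, fun x => ?_⟩
  rcases eq_or_ne x 0 with rfl | hx
  · simp
  have hn : 0 < ‖x‖ := norm_pos_iff.2 hx
  have h := hC (‖x‖⁻¹ • x) (by simp [norm_smul, hn.ne'])
  rw [quadratic_smul, Real.norm_eq_abs] at h
  have h2 := (le_abs_self _).trans (h.trans (le_max_left C 1))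
  rw [inv_pow, inv_mul_le_iff₀ (by positivity)] at h2
  linarith

theorem Matrix.PosDef.exists_le_quadratic {a : ℕ} {A : Matrix (Fin a) (Fin a) ℝ}
    (hA : A.PosDef) : ∃ ε > 0, ∀ x : Fin a → ℝ, ε * ‖x‖ ^ 2 ≤ x ⬝ᵥ A *ᵥ x := by
  obtain ⟨ε, hε, h⟩ := (isCompact_sphere (0 : Fin a → ℝ) 1).exists_forall_le'
    (continuous_quadratic A).continuousOn (a := 0)
    (fun x hx => hA.quadratic_pos (by rintro rfl; simp at hx))
  refine ⟨ε, hε, fun x => ?_⟩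
  rcases eq_or_ne x 0 with rfl | hx
  · simp
  have hn : 0 < ‖x‖ := norm_pos_iff.2 hx
  have h := h (‖x‖⁻¹ • x) (by simp [norm_smul, hn.ne'])
  rw [quadratic_smul, inv_pow, le_inv_mul_iff₀ (by positivity)] at h
  linarith

/-- The midpoint identity of a quadratic form, the source of strict convexity. -/
theorem quadratic_midpoint {a : ℕ} (A : Matrix (Fin a) (Fin a) ℝ) (x y : Fin a → ℝ) :
    ((1 / 2 : ℝ) • x + (1 / 2 : ℝ) • y) ⬝ᵥ A *ᵥ ((1 / 2 : ℝ) • x + (1 / 2 : ℝ) • y) =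
      (x ⬝ᵥ A *ᵥ x + y ⬝ᵥ A *ᵥ y) / 2 - ((x - y) ⬝ᵥ A *ᵥ (x - y)) / 4 := by
  simp only [Matrix.mulVec_add, Matrix.mulVec_sub, Matrix.mulVec_smul, add_dotProduct,
    sub_dotProduct, smul_dotProduct, dotProduct_add, dotProduct_sub, dotProduct_smul, smul_eq_mul]
  ring

namespace StripedMPC

/-! ### The Riccati equation -/

theorem inputWeight_posDef {n m q nc : ℕ} (M : StripedMPC n m q nc) (hR : M.R.PosDef)
    (hP : M.P.PosDef) : (M.R + M.Bᵀ * M.P * M.B).PosDef := by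
  have h := hP.posSemidef.conjTranspose_mul_mul_same M.B
  rw [Matrix.conjTranspose_eq_transpose_of_trivial] at h
  exact hR.add_posSemidef h

theorem inputWeight_mul_K {n m q nc : ℕ} (M : StripedMPC n m q nc) (hR : M.R.PosDef)
    (hP : M.P.PosDef) : M.Bᵀ * M.P * M.A = -((M.R + M.Bᵀ * M.P * M.B) * M.K) := by
  have hu := (Matrix.isUnit_iff_isUnit_det _).1 (M.inputWeight_posDef hR hP).isUnit
  rw [K, Matrix.mul_neg, neg_neg, Matrix.mul_assoc _ M.Bᵀ, Matrix.mul_assoc _ (M.Bᵀ * M.P),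
    Matrix.mul_nonsing_inv_cancel_left _ _ hu]

theorem transpose_B_mul_P_mul_Φ {n m q nc : ℕ} (M : StripedMPC n m q nc) (hR : M.R.PosDef)
    (hP : M.P.PosDef) : M.Bᵀ * M.P * M.Φ = -(M.R * M.K) := by
  rw [Φ, Matrix.mul_add, M.inputWeight_mul_K hR hP, Matrix.add_mul, ← Matrix.mul_assoc]
  abel

theorem lyapunov {n m q nc : ℕ} (M : StripedMPC n m q nc) (hR : M.R.PosDef)
    (hP : M.P.PosDef) (hRic : M.SolvesRiccati) : M.P - M.Φᵀ * M.P * M.Φ = M.S := by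
  have h1 := M.inputWeight_mul_K hR hP
  have h2 := M.transpose_B_mul_P_mul_Φ hR hP
  have h3 : M.Aᵀ * M.P * M.B = -(M.Kᵀ * (M.R + M.Bᵀ * M.P * M.B)) := by
    have h := congrArg Matrix.transpose h1
    simpa [Matrix.transpose_mul, hP.isSymm.eq, hR.isSymm.eq, Matrix.mul_assoc] using h
  have h4 : M.Φᵀ * M.P * M.Φ = M.Aᵀ * M.P * M.A + M.Aᵀ * M.P * M.B * M.K
      + M.Kᵀ * (M.Bᵀ * M.P * M.Φ) := by
    rw [Φ, Matrix.transpose_add, Matrix.transpose_mul]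
    simp only [Matrix.mul_add, Matrix.add_mul, Matrix.mul_assoc]
    abel
  rw [h4, h2, h3, S]
  nth_rw 1 [hRic]
  simp only [Matrix.neg_mul, Matrix.mul_neg, Matrix.mul_assoc]
  abel

theorem S_posDef {n m q nc : ℕ} (M : StripedMPC n m q nc) (hQ : M.Q.PosDef) (hR : M.R.PosDef) :
    M.S.PosDef := by
  have h := hR.posSemidef.conjTranspose_mul_mul_same M.K
  rw [Matrix.conjTranspose_eq_transpose_of_trivial] at h
  exact hQ.add_posSemidef h

/-- Along the unconstrained optimal law the value `xᵀ P x` drops by the stage cost `xᵀ S x`. -/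
theorem quadratic_P_Φ {n m q nc : ℕ} (M : StripedMPC n m q nc) (hR : M.R.PosDef)
    (hP : M.P.PosDef) (hRic : M.SolvesRiccati) (x : Fin n → ℝ) :
    (M.Φ *ᵥ x) ⬝ᵥ M.P *ᵥ (M.Φ *ᵥ x) = x ⬝ᵥ M.P *ᵥ x - x ⬝ᵥ M.S *ᵥ x := by
  rw [mulVec_dotProduct_mulVec_mulVec, ← M.lyapunov hR hP hRic, Matrix.sub_mulVec, dotProduct_sub]
  ring

/-- Completion of squares: `xᵀ P x + cᵀ (R + Bᵀ P B) c` is the stage cost of the input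
`u = K x + c` plus the value of `P` at the nominal successor state. -/
theorem quadratic_P_add_inputWeight {n m q nc : ℕ} (M : StripedMPC n m q nc) (hR : M.R.PosDef)
    (hP : M.P.PosDef) (hRic : M.SolvesRiccati) (x : Fin n → ℝ) (c : Fin m → ℝ) :
    x ⬝ᵥ M.P *ᵥ x + c ⬝ᵥ (M.R + M.Bᵀ * M.P * M.B) *ᵥ c =
      x ⬝ᵥ M.Q *ᵥ x + (M.K *ᵥ x + c) ⬝ᵥ M.R *ᵥ (M.K *ᵥ x + c) +
        (M.Φ *ᵥ x + M.B *ᵥ c) ⬝ᵥ M.P *ᵥ (M.Φ *ᵥ x + M.B *ᵥ c) := by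
  have hcross : (M.Φ *ᵥ x) ⬝ᵥ M.P *ᵥ (M.B *ᵥ c) = -((M.K *ᵥ x) ⬝ᵥ M.R *ᵥ c) := by
    rw [hP.isSymm.dotProduct_mulVec_comm, hR.isSymm.dotProduct_mulVec_comm,
      mulVec_dotProduct_mulVec_mulVec, M.transpose_B_mul_P_mul_Φ hR hP, Matrix.neg_mulVec,
      dotProduct_neg, Matrix.mulVec_mulVec]
  rw [hR.isSymm.dotProduct_mulVec_add, hP.isSymm.dotProduct_mulVec_add, hcross,
    M.quadratic_P_Φ hR hP hRic, mulVec_dotProduct_mulVec_mulVec, mulVec_dotProduct_mulVec_mulVec,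
    S, Matrix.add_mulVec, Matrix.add_mulVec, dotProduct_add, dotProduct_add]
  ring

/-! ### Predictions -/

theorem predState_succ {n m q nc : ℕ} (M : StripedMPC n m q nc) (x : Fin n → ℝ)
    (c : Fin M.N → Fin m → ℝ) (w : ℕ → Fin q → ℝ) (i : ℕ) :
    M.predState x c w (i + 1) = M.A *ᵥ M.predState x c w i +
      M.B *ᵥ M.policy c w i (M.predState x c w i) + M.D *ᵥ w i := rfl

theorem perturbation_add {n m q nc : ℕ} (M : StripedMPC n m q nc)
    (c c' : Fin M.N → Fin m → ℝ) (i : ℕ) :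
    M.perturbation (c + c') i = M.perturbation c i + M.perturbation c' i := by
  unfold perturbation
  split_ifs <;> simp

theorem perturbation_smul {n m q nc : ℕ} (M : StripedMPC n m q nc) (t : ℝ)
    (c : Fin M.N → Fin m → ℝ) (i : ℕ) :
    M.perturbation (t • c) i = t • M.perturbation c i := by
  unfold perturbation
  split_ifs <;> simp

theorem policy_add {n m q nc : ℕ} (M : StripedMPC n m q nc) (c c' : Fin M.N → Fin m → ℝ)
    (w w' : ℕ → Fin q → ℝ) (i : ℕ) (x x' : Fin n → ℝ) :
    M.policy (c + c') (w + w') i (x + x') = M.policy c w i x + M.policy c' w' i x' := by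
  simp only [policy, perturbation_add, Matrix.mulVec_add, Pi.add_apply, Finset.sum_add_distrib]
  abel

theorem policy_smul {n m q nc : ℕ} (M : StripedMPC n m q nc) (t : ℝ) (c : Fin M.N → Fin m → ℝ)
    (w : ℕ → Fin q → ℝ) (i : ℕ) (x : Fin n → ℝ) :
    M.policy (t • c) (t • w) i (t • x) = t • M.policy c w i x := by
  simp only [policy, perturbation_smul, Matrix.mulVec_smul, Pi.smul_apply, smul_add,
    Finset.smul_sum]

theorem predState_add {n m q nc : ℕ} (M : StripedMPC n m q nc) (x x' : Fin n → ℝ)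
    (c c' : Fin M.N → Fin m → ℝ) (w w' : ℕ → Fin q → ℝ) (i : ℕ) :
    M.predState (x + x') (c + c') (w + w') i = M.predState x c w i + M.predState x' c' w' i := by
  induction i with
  | zero => rfl
  | succ i ih =>
    simp only [predState_succ, ih, policy_add, Matrix.mulVec_add, Pi.add_apply]
    abel

theorem predState_smul {n m q nc : ℕ} (M : StripedMPC n m q nc) (t : ℝ) (x : Fin n → ℝ)
    (c : Fin M.N → Fin m → ℝ) (w : ℕ → Fin q → ℝ) (i : ℕ) :
    M.predState (t • x) (t • c) (t • w) i = t • M.predState x c w i := by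
  induction i with
  | zero => rfl
  | succ i ih => simp only [predState_succ, ih, policy_smul, Matrix.mulVec_smul, Pi.smul_apply,
      smul_add]

theorem predPair_add {n m q nc : ℕ} (M : StripedMPC n m q nc) (x x' : Fin n → ℝ)
    (c c' : Fin M.N → Fin m → ℝ) (w w' : ℕ → Fin q → ℝ) (i : ℕ) :
    M.predPair (x + x') (c + c') (w + w') i = M.predPair x c w i + M.predPair x' c' w' i := by
  simp only [predPair, predState_add, policy_add, Prod.mk_add_mk]

theorem predPair_smul {n m q nc : ℕ} (M : StripedMPC n m q nc) (t : ℝ) (x : Fin n → ℝ)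
    (c : Fin M.N → Fin m → ℝ) (w : ℕ → Fin q → ℝ) (i : ℕ) :
    M.predPair (t • x) (t • c) (t • w) i = t • M.predPair x c w i := by
  simp only [predPair, predState_smul, policy_smul, Prod.smul_mk]

theorem nominalPair_add_uncertainPair {n m q nc : ℕ} (M : StripedMPC n m q nc) (x : Fin n → ℝ)
    (c : Fin M.N → Fin m → ℝ) (w : ℕ → Fin q → ℝ) (i : ℕ) :
    M.nominalPair x c i + M.uncertainPair w i = M.predPair x c w i := by
  rw [nominalPair, uncertainPair, ← predPair_add, add_zero, add_zero, zero_add]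

theorem nominalPair_midpoint {n m q nc : ℕ} (M : StripedMPC n m q nc) (x : Fin n → ℝ)
    (c c' : Fin M.N → Fin m → ℝ) (i : ℕ) :
    M.nominalPair x ((1 / 2 : ℝ) • c + (1 / 2 : ℝ) • c') i =
      (1 / 2 : ℝ) • M.nominalPair x c i + (1 / 2 : ℝ) • M.nominalPair x c' i := by
  have hx : x = (1 / 2 : ℝ) • x + (1 / 2 : ℝ) • x := by rw [← add_smul]; norm_num
  have h0 : (0 : ℕ → Fin q → ℝ) = (1 / 2 : ℝ) • 0 + (1 / 2 : ℝ) • 0 := by simp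
  simp only [nominalPair]
  conv_lhs => rw [hx, h0]
  rw [predPair_add, predPair_smul, predPair_smul]

theorem continuous_predState {n m q nc : ℕ} (M : StripedMPC n m q nc) (w : ℕ → Fin q → ℝ)
    (i : ℕ) : Continuous fun z : (Fin n → ℝ) × (Fin M.N → Fin m → ℝ) =>
      M.predState z.1 z.2 w i := by
  induction i with
  | zero => exact continuous_fst
  | succ i ih =>
    simp only [predState_succ, policy, perturbation]
    split_ifs <;> fun_prop

theorem continuous_predPair {n m q nc : ℕ} (M : StripedMPC n m q nc) (w : ℕ → Fin q → ℝ)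
    (i : ℕ) : Continuous fun z : (Fin n → ℝ) × (Fin M.N → Fin m → ℝ) =>
      M.predPair z.1 z.2 w i := by
  have h := M.continuous_predState w i
  simp only [predPair, policy, perturbation]
  split_ifs <;> fun_prop

/-- The disturbance sequence `w, w' 0, w' 1, …`. -/
def consDisturbance {q : ℕ} (w : Fin q → ℝ) (w' : ℕ → Fin q → ℝ) : ℕ → Fin q → ℝ
  | 0 => w
  | i + 1 => w' i

/-- The perturbation sequence that continues the plan `c` after its first step, when the first
disturbance was `w`: the plan is shifted, and the stripes add the feedback `L (i + 1) w` of
that disturbance. -/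
noncomputable def shiftPlan {n m q nc : ℕ} (M : StripedMPC n m q nc) (c : Fin M.N → Fin m → ℝ)
    (w : Fin q → ℝ) : Fin M.N → Fin m → ℝ :=
  fun i => if (i : ℕ) + 1 < M.N then M.perturbation c (i + 1) + M.L (i + 1) *ᵥ w else 0

theorem perturbation_shiftPlan {n m q nc : ℕ} (M : StripedMPC n m q nc)
    (c : Fin M.N → Fin m → ℝ) (w : Fin q → ℝ) (i : ℕ) :
    M.perturbation (M.shiftPlan c w) i =
      if i + 1 < M.N then M.perturbation c (i + 1) + M.L (i + 1) *ᵥ w else 0 := by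
  by_cases h : i < M.N
  · simp only [perturbation, dif_pos h, shiftPlan]
  · rw [perturbation, dif_neg h, if_neg (by omega)]

theorem policy_shiftPlan {n m q nc : ℕ} (M : StripedMPC n m q nc) (c : Fin M.N → Fin m → ℝ)
    (w : Fin q → ℝ) (w' : ℕ → Fin q → ℝ) (i : ℕ) (x : Fin n → ℝ) :
    M.policy (M.shiftPlan c w) w' i x = M.policy c (consDisturbance w w') (i + 1) x := by
  have key : ∀ r ≤ i, ∑ j ∈ Finset.Icc 1 r, M.L j *ᵥ consDisturbance w w' (i + 1 - j) =
      ∑ j ∈ Finset.Icc 1 r, M.L j *ᵥ w' (i - j) := by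
    intro r hr
    refine Finset.sum_congr rfl fun j hj => ?_
    rw [Finset.mem_Icc] at hj
    rw [show i + 1 - j = (i - j) + 1 by omega]
    rfl
  rw [policy, policy, perturbation_shiftPlan]
  by_cases h : i + 1 < M.N
  · rw [if_pos h, min_eq_left (by omega : i ≤ M.N - 1), min_eq_left (by omega : i + 1 ≤ M.N - 1),
      Finset.sum_Icc_succ_top (by omega), key i le_rfl, Nat.sub_self]
    simp only [consDisturbance]
    abel
  · have h0 : M.perturbation c (i + 1) = 0 := dif_neg h
    rw [if_neg h, h0, min_eq_right (by omega : M.N - 1 ≤ i + 1)]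
    rcases le_or_gt (M.N - 1) i with h' | h'
    · rw [min_eq_right h', key _ h']
    · omega

/-- The successor of `x` under the plan `c` and the disturbance `w`. -/
noncomputable def successor {n m q nc : ℕ} (M : StripedMPC n m q nc) (x : Fin n → ℝ)
    (c : Fin M.N → Fin m → ℝ) (w : Fin q → ℝ) : Fin n → ℝ :=
  M.Φ *ᵥ x + M.B *ᵥ M.perturbation c 0 + M.D *ᵥ w

/-- Predictions are consistent in time: the predictions made at the successor state with the
shifted plan are those of the original plan, one step later. -/
theorem predState_shiftPlan {n m q nc : ℕ} (M : StripedMPC n m q nc) (x : Fin n → ℝ)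
    (c : Fin M.N → Fin m → ℝ) (w : Fin q → ℝ) (w' : ℕ → Fin q → ℝ) (i : ℕ) :
    M.predState (M.successor x c w) (M.shiftPlan c w) w' i =
      M.predState x c (consDisturbance w w') (i + 1) := by
  induction i with
  | zero =>
    simp only [predState, successor, policy, Φ, consDisturbance, Matrix.add_mulVec,
      Matrix.mulVec_add, Matrix.mulVec_mulVec]
    simp [add_assoc]
  | succ i ih => rw [predState_succ, ih, predState_succ, policy_shiftPlan]; rfl

theorem predPair_shiftPlan {n m q nc : ℕ} (M : StripedMPC n m q nc) (x : Fin n → ℝ)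
    (c : Fin M.N → Fin m → ℝ) (w : Fin q → ℝ) (w' : ℕ → Fin q → ℝ) (i : ℕ) :
    M.predPair (M.successor x c w) (M.shiftPlan c w) w' i =
      M.predPair x c (consDisturbance w w') (i + 1) := by
  simp only [predPair, predState_shiftPlan, policy_shiftPlan]

theorem closedLoopMap_eq_successor {n m q nc : ℕ} (M : StripedMPC n m q nc) (x : Fin n → ℝ)
    (w : Fin q → ℝ) : M.closedLoopMap x w = M.successor x (M.optimizer x) w := rfl

/-! ### Feasibility -/

theorem nominalPair_mem_tightened_iff {n m q nc : ℕ} (M : StripedMPC n m q nc)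
    (T : Set ((Fin n → ℝ) × (Fin m → ℝ))) (x : Fin n → ℝ) (c : Fin M.N → Fin m → ℝ) (i : ℕ) :
    M.nominalPair x c i ∈ M.tightened T i ↔
      ∀ w : ℕ → Fin q → ℝ, (∀ l, w l ∈ M.W) → M.predPair x c w i ∈ T := by
  simp only [tightened, Set.mem_ofPred_eq, nominalPair_add_uncertainPair]

/-- Recursive feasibility: after any admissible disturbance the shifted plan is feasible. -/
theorem Feasible.shiftPlan {n m q nc : ℕ} {M : StripedMPC n m q nc} (hN₂ : M.HorizonLongEnough)
    {x : Fin n → ℝ} {c : Fin M.N → Fin m → ℝ} (hc : M.Feasible x c) {w : Fin q → ℝ}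
    (hw : w ∈ M.W) : M.Feasible (M.successor x c w) (M.shiftPlan c w) := by
  have hall : ∀ i, M.nominalPair x c i ∈ M.tightened M.probSet i ∩ M.tightened M.Z i := by
    intro i
    rcases lt_or_ge i M.N with h | h
    · exact hc i (by omega)
    · exact hN₂ x c hc i h
  have hcons : ∀ w' : ℕ → Fin q → ℝ, (∀ l, w' l ∈ M.W) → ∀ l, consDisturbance w w' l ∈ M.W := by
    intro w' hw' l
    cases l with
    | zero => exact hw
    | succ l => exact hw' l
  intro i _
  have h := hall (i + 1)
  simp only [Set.mem_inter_iff, nominalPair_mem_tightened_iff, predPair_shiftPlan] at h ⊢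
  exact ⟨fun w' hw' => h.1 _ (hcons w' hw'), fun w' hw' => h.2 _ (hcons w' hw')⟩

theorem convex_probSet {n m q nc : ℕ} (M : StripedMPC n m q nc) : Convex ℝ M.probSet := by
  intro z hz z' hz' a b ha hb hab j
  have h1 := mul_le_mul_of_nonneg_left (hz j) ha
  have h2 := mul_le_mul_of_nonneg_left (hz' j) hb
  have h3 : M.γ j = a * M.γ j + b * M.γ j := by rw [← add_mul, hab, one_mul]
  have h4 : M.h j = a * M.h j + b * M.h j := by rw [← add_mul, hab, one_mul]
  rw [h3, h4]
  simp only [Prod.fst_add, Prod.snd_add, Prod.smul_fst, Prod.smul_snd, Matrix.mulVec_add,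
    Matrix.mulVec_smul, dotProduct_add, dotProduct_smul, smul_eq_mul] at h1 h2 ⊢
  linarith

theorem isClosed_probSet {n m q nc : ℕ} (M : StripedMPC n m q nc) : IsClosed M.probSet := by
  simp only [probSet, Set.ofPred_forall]
  exact isClosed_iInter fun j => isClosed_le (by fun_prop) (by fun_prop)

end StripedMPC

theorem IsPolyhedron.convex {E : Type*} [AddCommGroup E] [Module ℝ E] {Z : Set E}
    (hZ : IsPolyhedron Z) : Convex ℝ Z := by
  obtain ⟨r, a, b, rfl⟩ := hZ
  rw [Set.ofPred_forall]
  exact convex_iInter fun i => convex_halfSpace_le (a i).isLinear (b i)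

namespace StripedMPC

theorem convex_tightened {n m q nc : ℕ} (M : StripedMPC n m q nc)
    {T : Set ((Fin n → ℝ) × (Fin m → ℝ))} (hT : Convex ℝ T) (i : ℕ) :
    Convex ℝ (M.tightened T i) := by
  simp only [tightened, Set.ofPred_forall]
  exact convex_iInter fun w => convex_iInter fun _ => hT.translate_preimage_left _

theorem Feasible.midpoint {n m q nc : ℕ} {M : StripedMPC n m q nc} (hZ : IsPolyhedron M.Z)
    {x : Fin n → ℝ} {c c' : Fin M.N → Fin m → ℝ} (hc : M.Feasible x c) (hc' : M.Feasible x c') :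
    M.Feasible x ((1 / 2 : ℝ) • c + (1 / 2 : ℝ) • c') := by
  intro i hi
  rw [nominalPair_midpoint]
  have hconv : Convex ℝ (M.tightened M.probSet i ∩ M.tightened M.Z i) :=
    (M.convex_tightened M.convex_probSet i).inter (M.convex_tightened hZ.convex i)
  exact hconv (hc i hi) (hc' i hi) (by norm_num) (by norm_num) (by norm_num)

/-- The set of feasible pairs of a state and a plan. -/
def feasiblePairs {n m q nc : ℕ} (M : StripedMPC n m q nc) :
    Set ((Fin n → ℝ) × (Fin M.N → Fin m → ℝ)) :=
  {z | M.Feasible z.1 z.2}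

theorem isClosed_feasiblePairs {n m q nc : ℕ} (M : StripedMPC n m q nc) (hZ : IsClosed M.Z) :
    IsClosed M.feasiblePairs := by
  have h : M.feasiblePairs = ⋂ (i : ℕ) (_ : i < M.N + M.N₂) (w : ℕ → Fin q → ℝ)
      (_ : ∀ l, w l ∈ M.W), (fun z : (Fin n → ℝ) × (Fin M.N → Fin m → ℝ) =>
        M.predPair z.1 z.2 w i) ⁻¹' (M.probSet ∩ M.Z) := by
    ext z
    simp only [feasiblePairs, Feasible, Set.mem_inter_iff, nominalPair_mem_tightened_iff,
      Set.mem_ofPred_eq, Set.mem_iInter, Set.mem_preimage]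
    exact ⟨fun h i hi w hw => ⟨(h i hi).1 w hw, (h i hi).2 w hw⟩,
      fun h i hi => ⟨fun w hw => (h i hi w hw).1, fun w hw => (h i hi w hw).2⟩⟩
  rw [h]
  exact isClosed_iInter fun i => isClosed_iInter fun _ => isClosed_iInter fun w =>
    isClosed_iInter fun _ => (M.isClosed_probSet.inter hZ).preimage (M.continuous_predPair w i)

theorem policy_zero_disturbance {n m q nc : ℕ} (M : StripedMPC n m q nc)
    (c : Fin M.N → Fin m → ℝ) (i : ℕ) (x : Fin n → ℝ) :
    M.policy c 0 i x = M.K *ᵥ x + M.perturbation c i := by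
  simp [policy]

/-- The feasible pairs form a compact set: the state and, through `c i = ū i - K x̄ i`, the plan
are controlled by nominal pairs in the compact set `Z`. -/
theorem isCompact_feasiblePairs {n m q nc : ℕ} (M : StripedMPC n m q nc) (hZc : IsCompact M.Z)
    (hW0 : (0 : Fin q → ℝ) ∈ M.W) (hN : 1 ≤ M.N) : IsCompact M.feasiblePairs := by
  have hnom : ∀ z ∈ M.feasiblePairs, ∀ i < M.N, M.predPair z.1 z.2 0 i ∈ M.Z := fun z hz i hi =>
    (M.nominalPair_mem_tightened_iff _ _ _ _).1 (hz i (by omega)).2 0 fun _ => hW0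
  obtain ⟨C₁, hC₁⟩ := hZc.exists_bound_of_continuousOn continuous_fst.continuousOn
  obtain ⟨C₂, hC₂⟩ := hZc.exists_bound_of_continuousOn
    (f := fun z => z.2 - M.K *ᵥ z.1) (by fun_prop)
  refine Metric.isCompact_of_isClosed_isBounded (M.isClosed_feasiblePairs hZc.isClosed)
    ((Metric.isBounded_closedBall (x := 0) (r := max C₁ (max C₂ 0))).subset fun z hz => ?_)
  rw [mem_closedBall_zero_iff, Prod.norm_def]
  refine max_le ((hC₁ _ (hnom z hz 0 hN)).trans (le_max_left _ _)) ?_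
  refine ((pi_norm_le_iff_of_nonneg (le_max_right C₂ 0)).2 fun i => ?_).trans (le_max_right _ _)
  have h := hC₂ _ (hnom z hz i i.2)
  have hi : M.perturbation z.2 i = z.2 i := dif_pos i.2
  rw [predPair, policy_zero_disturbance, hi, add_sub_cancel_left] at h
  exact h.trans (le_max_left _ _)

end StripedMPC

/-! ### The optimizer -/

/-- The unique minimizer of a continuous cost over the fibres of a compact set depends measurably
on the parameter. The minimizer at `x` lies in a closed set `C'` exactly when every rational
level that is attained over the fibre of `x` is attained in `C'`, and for each level the set of
such parameters is the projection of a compact set. -/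
theorem measurable_argmin {X C : Type*} [MetricSpace X] [MeasurableSpace X] [BorelSpace X]
    [MetricSpace C] [MeasurableSpace C] [BorelSpace C] {F : Set (X × C)} (hF : IsCompact F)
    {J : X × C → ℝ} (hJ : Continuous J) {s : X → C} {c₀ : C}
    (hs : ∀ x ∈ Prod.fst '' F, (x, s x) ∈ F ∧ ∀ c, (x, c) ∈ F → J (x, s x) ≤ J (x, c))
    (huniq : ∀ x c, (x, c) ∈ F → J (x, c) ≤ J (x, s x) → c = s x)
    (hs₀ : ∀ x ∉ Prod.fst '' F, s x = c₀) : Measurable s := by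
  have hmeas : ∀ C' : Set C, IsClosed C' → ∀ t : ℝ,
      MeasurableSet (Prod.fst '' (F ∩ {z | z.2 ∈ C' ∧ J z ≤ t})) := by
    intro C' hC' t
    refine ((hF.inter_right ?_).image continuous_fst).isClosed.measurableSet
    exact (hC'.preimage continuous_snd).inter (isClosed_le hJ continuous_const)
  have hFm : MeasurableSet (Prod.fst '' F) := (hF.image continuous_fst).isClosed.measurableSet
  refine measurable_of_isClosed fun C' hC' => ?_
  have key : s ⁻¹' C' = (Prod.fst '' F ∩ ⋂ t : ℚ,
      ((Prod.fst '' (F ∩ {z | z.2 ∈ Set.univ ∧ J z ≤ t}))ᶜ ∪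
        Prod.fst '' (F ∩ {z | z.2 ∈ C' ∧ J z ≤ t}))) ∪
      ((Prod.fst '' F)ᶜ ∩ {_x | c₀ ∈ C'}) := by
    ext x
    by_cases hx : x ∈ Prod.fst '' F
    · obtain ⟨hsx, hmin⟩ := hs x hx
      simp only [Set.mem_preimage, Set.mem_union, Set.mem_inter_iff, hx, true_and,
        Set.mem_compl_iff, not_true_eq_false, false_and, or_false, Set.mem_iInter]
      constructor
      · intro hC t
        by_cases ht : J (x, s x) ≤ t
        · exact Or.inr ⟨(x, s x), ⟨hsx, hC, ht⟩, rfl⟩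
        · refine Or.inl ?_
          rintro ⟨⟨y, c⟩, ⟨hyF, -, hyt⟩, rfl⟩
          exact ht ((hmin c hyF).trans hyt)
      · intro h
        -- the part of the fibre of `x` that lies over `C'`
        have hcomp : IsCompact (F ∩ {z | z.1 = x ∧ z.2 ∈ C'}) := hF.inter_right
          ((isClosed_eq continuous_fst continuous_const).inter (hC'.preimage continuous_snd))
        have hlevel : ∀ t : ℚ, J (x, s x) ≤ t → ∃ c ∈ C', (x, c) ∈ F ∧ J (x, c) ≤ t := by
          intro t ht
          rcases h t with h | h
          · exact absurd ⟨(x, s x), ⟨hsx, trivial, ht⟩, rfl⟩ h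
          · obtain ⟨⟨y, c⟩, ⟨hyF, hyC, hyt⟩, rfl⟩ := h
            exact ⟨c, hyC, hyF, hyt⟩
        obtain ⟨t₀, ht₀⟩ := exists_rat_gt (J (x, s x))
        obtain ⟨c₁, hc₁C, hc₁F, -⟩ := hlevel t₀ ht₀.le
        obtain ⟨⟨y, c⟩, ⟨hcF, rfl, hcC⟩, hcmin⟩ :=
          hcomp.exists_isMinOn ⟨(x, c₁), hc₁F, rfl, hc₁C⟩ hJ.continuousOn
        have hle : J (y, c) ≤ J (y, s y) := by
          refine le_of_forall_rat_lt_imp_le ?_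
          intro t ht
          by_contra hlt
          push Not at hlt
          obtain ⟨t', ht', ht''⟩ := exists_rat_btwn hlt
          obtain ⟨c', hc'C, hc'F, hc't⟩ := hlevel t' ht'.le
          have := hcmin (show (y, c') ∈ F ∩ {z | z.1 = y ∧ z.2 ∈ C'} from ⟨hc'F, rfl, hc'C⟩)
          simp only [Set.mem_ofPred_eq] at this
          linarith
        rw [← huniq y c hcF hle]
        exact hcC
    · simp only [Set.mem_preimage, Set.mem_union, Set.mem_inter_iff, hx, false_and, false_or,
        Set.mem_compl_iff, not_false_eq_true, true_and, hs₀ x hx, Set.mem_ofPred_eq]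
  rw [key]
  exact (hFm.inter (MeasurableSet.iInter fun t : ℚ => (hmeas _ isClosed_univ t).compl.union
    (hmeas _ hC' t))).union (hFm.compl.inter (MeasurableSet.const _))

namespace StripedMPC

theorem continuous_cost {n m q nc : ℕ} (M : StripedMPC n m q nc) :
    Continuous fun z : (Fin n → ℝ) × (Fin M.N → Fin m → ℝ) => M.cost z.1 z.2 := by
  unfold cost
  exact ((continuous_quadratic _).comp continuous_fst).add (continuous_finsetSum _ fun i _ =>
    (continuous_quadratic _).comp ((continuous_apply i).comp continuous_snd))

theorem cost_nonneg {n m q nc : ℕ} (M : StripedMPC n m q nc) (hR : M.R.PosDef) (hP : M.P.PosDef)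
    (x : Fin n → ℝ) (c : Fin M.N → Fin m → ℝ) : 0 ≤ M.cost x c :=
  add_nonneg (hP.quadratic_nonneg x) (Finset.sum_nonneg fun i _ =>
    (M.inputWeight_posDef hR hP).quadratic_nonneg (c i))

theorem feasibleStates_eq_image {n m q nc : ℕ} (M : StripedMPC n m q nc) :
    M.feasibleStates = Prod.fst '' M.feasiblePairs := by
  ext x
  simp [feasibleStates, feasiblePairs]

theorem isOptimal_optimizer {n m q nc : ℕ} (M : StripedMPC n m q nc)
    (hF : IsCompact M.feasiblePairs) {x : Fin n → ℝ} (hx : x ∈ M.feasibleStates) :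
    M.IsOptimal x (M.optimizer x) := by
  have hex : ∃ c, M.IsOptimal x c := by
    obtain ⟨c₀, hc₀⟩ := hx
    have hcomp : IsCompact (M.feasiblePairs ∩ {z | z.1 = x}) :=
      hF.inter_right (isClosed_eq continuous_fst continuous_const)
    obtain ⟨⟨y, c⟩, ⟨hcF, rfl⟩, hmin⟩ :=
      hcomp.exists_isMinOn ⟨(x, c₀), hc₀, rfl⟩ M.continuous_cost.continuousOn
    exact ⟨c, hcF, fun c' hc' =>
      hmin (show (y, c') ∈ M.feasiblePairs ∩ {z | z.1 = y} from ⟨hc', rfl⟩)⟩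
  rw [optimizer, dif_pos hex]
  exact hex.choose_spec

theorem IsOptimal.eq {n m q nc : ℕ} {M : StripedMPC n m q nc} (hR : M.R.PosDef)
    (hP : M.P.PosDef) (hZ : IsPolyhedron M.Z) {x : Fin n → ℝ} {c c' : Fin M.N → Fin m → ℝ}
    (hc : M.IsOptimal x c) (hc' : M.Feasible x c') (hle : M.cost x c' ≤ M.cost x c) :
    c' = c := by
  have hH := M.inputWeight_posDef hR hP
  by_contra hne
  obtain ⟨i, hi⟩ := Function.ne_iff.1 hne
  have hmid := hc.2 _ (hc'.midpoint hZ hc.1)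
  have hpos : 0 < ∑ i, (c' i - c i) ⬝ᵥ (M.R + M.Bᵀ * M.P * M.B) *ᵥ (c' i - c i) :=
    Finset.sum_pos' (fun i _ => hH.quadratic_nonneg _)
      ⟨i, Finset.mem_univ i, hH.quadratic_pos (sub_ne_zero.2 hi)⟩
  simp only [cost, Pi.add_apply, Pi.smul_apply, quadratic_midpoint, Finset.sum_sub_distrib,
    ← Finset.sum_div, Finset.sum_add_distrib] at hmid hle
  linarith

theorem measurable_optimizer {n m q nc : ℕ} (M : StripedMPC n m q nc) (hR : M.R.PosDef)
    (hP : M.P.PosDef) (hZ : IsPolyhedron M.Z) (hF : IsCompact M.feasiblePairs) :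
    Measurable M.optimizer := by
  refine measurable_argmin hF M.continuous_cost (c₀ := 0) ?_ ?_ ?_
  · intro x hx
    rw [← feasibleStates_eq_image] at hx
    exact M.isOptimal_optimizer hF hx
  · intro x c hc hle
    exact (M.isOptimal_optimizer hF ⟨c, hc⟩).eq hR hP hZ hc hle
  · intro x hx
    rw [← feasibleStates_eq_image] at hx
    exact dif_neg fun ⟨c, hc⟩ => hx ⟨c, hc.1⟩

theorem measurable_perturbation_optimizer {n m q nc : ℕ} (M : StripedMPC n m q nc)
    (hopt : Measurable M.optimizer) : Measurable fun x => M.perturbation (M.optimizer x) 0 := by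
  unfold perturbation
  split_ifs
  · exact (measurable_pi_apply _).comp hopt
  · exact measurable_const

/-! ### The minimal RPI set -/

theorem isRPI_feasibleStates {n m q nc : ℕ} (M : StripedMPC n m q nc)
    (hN₂ : M.HorizonLongEnough) (hF : IsCompact M.feasiblePairs) :
    IsRPI M.closedLoopMap M.W M.feasibleStates := fun _ hx _ hw =>
  ⟨_, (M.isOptimal_optimizer hF hx).1.shiftPlan hN₂ hw⟩

theorem zero_mem_minRPI {n m q nc : ℕ} (M : StripedMPC n m q nc) :
    (0 : Fin n → ℝ) ∈ M.minRPI := fun _ hY => hY.1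

theorem isRPI_minRPI {n m q nc : ℕ} (M : StripedMPC n m q nc) :
    IsRPI M.closedLoopMap M.W M.minRPI := fun x hx w hw Y hY => hY.2.2 x (hx Y hY) w hw

theorem closedLoopMap_of_mem_unconstrainedRegion {n m q nc : ℕ} (M : StripedMPC n m q nc)
    {x : Fin n → ℝ} (hx : x ∈ M.unconstrainedRegion) (w : Fin q → ℝ) :
    M.closedLoopMap x w = M.Φ *ᵥ x + M.D *ᵥ w := by
  rw [closedLoopMap, hx.2, Matrix.mulVec_zero, add_zero]

/-- The states reachable from the origin by the unconstrained loop lie in the minimal RPI set. -/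
theorem reachable_mem_minRPI {n m q nc : ℕ} (M : StripedMPC n m q nc)
    (huc : M.minRPI ⊆ M.unconstrainedRegion) (k : ℕ) (w : ℕ → Fin q → ℝ)
    (hw : ∀ i < k, w i ∈ M.W) :
    ∑ i ∈ Finset.range k, (M.Φ ^ i * M.D) *ᵥ w i ∈ M.minRPI := by
  induction k generalizing w with
  | zero => simpa using M.zero_mem_minRPI
  | succ k ih =>
    have h := ih (fun i => w (i + 1)) fun i hi => hw _ (by omega)
    have h' := M.isRPI_minRPI _ h (w 0) (hw 0 (by omega))
    rw [M.closedLoopMap_of_mem_unconstrainedRegion (huc h), Matrix.mulVec_sum] at h'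
    rw [Finset.sum_range_succ']
    simpa only [Matrix.mulVec_mulVec, ← Matrix.mul_assoc, ← pow_succ', pow_zero,
      Matrix.one_mul] using h'

/-- By controllability the reachable states, hence the minimal RPI set, fill a neighbourhood of
the origin: a surjective linear map is open. -/
theorem minRPI_mem_nhds {n m q nc : ℕ} (M : StripedMPC n m q nc)
    (hW0 : (0 : Fin q → ℝ) ∈ interior M.W) (hctrl : IsControllablePair M.Φ M.D)
    (huc : M.minRPI ⊆ M.unconstrainedRegion) : M.minRPI ∈ 𝓝 (0 : Fin n → ℝ) := by
  let Λ : (Fin n → Fin q → ℝ) →ₗ[ℝ] (Fin n → ℝ) :=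
    ∑ i : Fin n, (Matrix.toLin' (M.Φ ^ (i : ℕ) * M.D)).comp (LinearMap.proj i)
  have hΛ : ∀ v, Λ v = ∑ i : Fin n, (M.Φ ^ (i : ℕ) * M.D) *ᵥ v i := by
    intro v
    simp only [Λ, LinearMap.sum_apply, LinearMap.comp_apply, LinearMap.proj_apply,
      Matrix.toLin'_apply]
  have hsurj : Function.Surjective Λ := by
    rw [← LinearMap.range_eq_top, eq_top_iff, ← hctrl]
    refine iSup_le fun j => ?_
    rintro _ ⟨v, rfl⟩
    refine ⟨Pi.single j v, ?_⟩
    rw [hΛ, Finset.sum_eq_single j]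
    · rw [Pi.single_eq_same, Matrix.toLin'_apply]
    · intro i _ hij
      simp [hij]
    · simp
  have hWn : Set.univ.pi (fun _ : Fin n => M.W) ∈ 𝓝 (0 : Fin n → Fin q → ℝ) :=
    set_pi_mem_nhds Set.finite_univ fun i _ => mem_interior_iff_mem_nhds.1 hW0
  have himg := (LinearMap.isOpenMap_of_finiteDimensional Λ hsurj).image_mem_nhds hWn
  rw [map_zero] at himg
  refine mem_of_superset himg ?_
  rintro _ ⟨v, hv, rfl⟩
  have h := M.reachable_mem_minRPI huc n (fun i => if hi : i < n then v ⟨i, hi⟩ else 0)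
    (fun i hi => by simpa [hi] using hv ⟨i, hi⟩ trivial)
  rw [Finset.sum_range] at h
  rw [hΛ]
  simpa using h

/-! ### Entrance into the minimal RPI set -/

theorem cost_eq_sum_range {n m q nc : ℕ} (M : StripedMPC n m q nc) (x : Fin n → ℝ)
    (c : Fin M.N → Fin m → ℝ) :
    M.cost x c = x ⬝ᵥ M.P *ᵥ x + ∑ i ∈ Finset.range M.N,
      M.perturbation c i ⬝ᵥ (M.R + M.Bᵀ * M.P * M.B) *ᵥ M.perturbation c i := by
  rw [cost, Finset.sum_range]
  simp [perturbation]

/-- Without disturbance the cost of the shifted plan is lower by at least the stage cost of the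
state. -/
theorem cost_shiftPlan_zero_le {n m q nc : ℕ} (M : StripedMPC n m q nc) (hR : M.R.PosDef)
    (hP : M.P.PosDef) (hRic : M.SolvesRiccati) (x : Fin n → ℝ) (c : Fin M.N → Fin m → ℝ) :
    M.cost (M.successor x c 0) (M.shiftPlan c 0) ≤ M.cost x c - x ⬝ᵥ M.Q *ᵥ x := by
  have hshift : ∀ i, M.perturbation (M.shiftPlan c 0) i = M.perturbation c (i + 1) := by
    intro i
    rw [perturbation_shiftPlan, Matrix.mulVec_zero, add_zero]
    split_ifs with h
    · rfl
    · rw [perturbation, dif_neg h]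
  have hend : M.perturbation c M.N = 0 := dif_neg (lt_irrefl _)
  have hsq := M.quadratic_P_add_inputWeight hR hP hRic x (M.perturbation c 0)
  have hRn := hR.quadratic_nonneg (M.K *ᵥ x + M.perturbation c 0)
  rw [cost_eq_sum_range, cost_eq_sum_range]
  simp only [hshift, successor, Matrix.mulVec_zero, add_zero]
  have hsum := Finset.sum_range_succ' (fun i =>
    M.perturbation c i ⬝ᵥ (M.R + M.Bᵀ * M.P * M.B) *ᵥ M.perturbation c i) M.N
  rw [Finset.sum_range_succ, hend, zero_dotProduct, add_zero] at hsum
  linarith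

theorem continuous_cost_shiftPlan {n m q nc : ℕ} (M : StripedMPC n m q nc) :
    Continuous fun z : ((Fin n → ℝ) × (Fin M.N → Fin m → ℝ)) × (Fin q → ℝ) =>
      M.cost (M.successor z.1.1 z.1.2 z.2) (M.shiftPlan z.1.2 z.2) := by
  have hpert : ∀ i, Continuous fun z : ((Fin n → ℝ) × (Fin M.N → Fin m → ℝ)) × (Fin q → ℝ) =>
      M.perturbation z.1.2 i := by
    intro i
    unfold perturbation
    split_ifs <;> fun_prop
  have hsucc : Continuous fun z : ((Fin n → ℝ) × (Fin M.N → Fin m → ℝ)) × (Fin q → ℝ) =>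
      M.successor z.1.1 z.1.2 z.2 := by
    have := hpert 0
    unfold successor
    fun_prop
  have hshift : Continuous fun z : ((Fin n → ℝ) × (Fin M.N → Fin m → ℝ)) × (Fin q → ℝ) =>
      M.shiftPlan z.1.2 z.2 := by
    refine continuous_pi fun i => ?_
    have := hpert (i + 1)
    by_cases h : (i : ℕ) + 1 < M.N
    · simp only [shiftPlan, if_pos h]
      fun_prop
    · simp only [shiftPlan, if_neg h]
      fun_prop
  exact M.continuous_cost.comp (hsucc.prodMk hshift)

/-- The optimal cost, as a function of the state. -/
noncomputable def valueFunction {n m q nc : ℕ} (M : StripedMPC n m q nc) (x : Fin n → ℝ) : ℝ :=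
  M.cost x (M.optimizer x)

/-- Under sufficiently small disturbances the optimal cost drops by the stage cost of the state,
up to an error `δ` that is uniform over the feasible states. -/
theorem exists_valueFunction_closedLoopMap_le {n m q nc : ℕ} (M : StripedMPC n m q nc)
    (hR : M.R.PosDef) (hP : M.P.PosDef) (hRic : M.SolvesRiccati) (hN₂ : M.HorizonLongEnough)
    (hF : IsCompact M.feasiblePairs) {δ : ℝ} (hδ : 0 < δ) :
    ∃ r > 0, ∀ x ∈ M.feasibleStates, ∀ w ∈ M.W, ‖w‖ ≤ r →
      M.valueFunction (M.closedLoopMap x w) ≤ M.valueFunction x - x ⬝ᵥ M.Q *ᵥ x + δ := by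
  have hK : IsCompact (M.feasiblePairs ×ˢ Metric.closedBall (0 : Fin q → ℝ) 1) :=
    hF.prod (isCompact_closedBall 0 1)
  have huc := hK.uniformContinuousOn_of_continuous M.continuous_cost_shiftPlan.continuousOn
  obtain ⟨ρ, hρ, h⟩ := Metric.uniformContinuousOn_iff.1 huc δ hδ
  refine ⟨min (ρ / 2) 1, by positivity, fun x hx w hw hwr => ?_⟩
  have hopt := M.isOptimal_optimizer hF hx
  have hfeas := hopt.1.shiftPlan hN₂ hw
  have hnext := (M.isOptimal_optimizer hF ⟨_, hfeas⟩).2 _ hfeas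
  have hclose := h ((x, M.optimizer x), w) ⟨hopt.1, by simpa using hwr.trans (min_le_right _ _)⟩
    ((x, M.optimizer x), 0) ⟨hopt.1, by simp⟩ (by
      have := hwr.trans (min_le_left _ _)
      rw [Prod.dist_eq, dist_self, dist_zero_right]
      exact max_lt hρ (by linarith))
  have hzero := M.cost_shiftPlan_zero_le hR hP hRic x (M.optimizer x)
  rw [Real.dist_eq] at hclose
  have habs := (abs_lt.1 hclose).2
  simp only at habs
  rw [valueFunction, valueFunction, closedLoopMap_eq_successor]
  linarith

theorem closedLoop_add {n m q nc : ℕ} (M : StripedMPC n m q nc) (x : Fin n → ℝ)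
    (w : ℕ → Fin q → ℝ) (s k : ℕ) :
    M.closedLoop x w (s + k) = M.closedLoop (M.closedLoop x w s) (fun i => w (s + i)) k := by
  induction k with
  | zero => rfl
  | succ k ih => rw [← add_assoc, closedLoop, closedLoop, ih]

theorem closedLoop_mem_of_isRPI {n m q nc : ℕ} (M : StripedMPC n m q nc) {Y : Set (Fin n → ℝ)}
    (hY : IsRPI M.closedLoopMap M.W Y) {x : Fin n → ℝ} (hx : x ∈ Y) {w : ℕ → Fin q → ℝ}
    (hw : ∀ k, w k ∈ M.W) (k : ℕ) : M.closedLoop x w k ∈ Y := by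
  induction k with
  | zero => exact hx
  | succ k ih => exact hY _ ih _ (hw k)

/-- A long enough run of small disturbances steers every feasible state into the minimal RPI set:
outside a ball contained in that set, the optimal cost drops by a fixed amount per step. -/
theorem exists_closedLoop_mem_minRPI {n m q nc : ℕ} (M : StripedMPC n m q nc) (hQ : M.Q.PosDef)
    (hR : M.R.PosDef) (hP : M.P.PosDef) (hRic : M.SolvesRiccati) (hN₂ : M.HorizonLongEnough)
    (hF : IsCompact M.feasiblePairs) (hnhds : M.minRPI ∈ 𝓝 (0 : Fin n → ℝ)) :
    ∃ r > 0, ∃ T : ℕ, ∀ x ∈ M.feasibleStates, ∀ w : ℕ → Fin q → ℝ, (∀ k, w k ∈ M.W) →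
      (∀ k < T, ‖w k‖ ≤ r) → ∃ k, M.closedLoop x w k ∈ M.minRPI := by
  obtain ⟨ε, hε, hball⟩ := Metric.mem_nhds_iff.1 hnhds
  obtain ⟨a, ha, hQa⟩ := hQ.exists_le_quadratic
  have hδ : 0 < a * ε ^ 2 / 2 := by positivity
  obtain ⟨r, hr, hdrop⟩ := M.exists_valueFunction_closedLoopMap_le hR hP hRic hN₂ hF hδ
  obtain ⟨C, hC⟩ := hF.exists_bound_of_continuousOn M.continuous_cost.continuousOn
  obtain ⟨T, hT⟩ := exists_nat_gt (C / (a * ε ^ 2 / 2))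
  rw [div_lt_iff₀ hδ] at hT
  refine ⟨r, hr, T, fun x hx w hw hwr => ?_⟩
  by_contra! hout
  have hX := M.closedLoop_mem_of_isRPI (M.isRPI_feasibleStates hN₂ hF) hx hw
  have hdec : ∀ k ≤ T, M.valueFunction (M.closedLoop x w k) ≤ C - k * (a * ε ^ 2 / 2) := by
    intro k
    induction k with
    | zero =>
      intro _
      have := (le_abs_self _).trans (hC (x, M.optimizer x) (M.isOptimal_optimizer hF hx).1)
      simpa [closedLoop, valueFunction] using this
    | succ k ih =>
      intro hk
      have h1 := hdrop _ (hX k) (w k) (hw k) (hwr k (by omega))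
      have h2 := ih (by omega)
      have h3 : ε ≤ ‖M.closedLoop x w k‖ := by
        by_contra! hlt
        exact hout k (hball (mem_ball_zero_iff.2 hlt))
      have h4 := hQa (M.closedLoop x w k)
      have h5 : a * ε ^ 2 ≤ a * ‖M.closedLoop x w k‖ ^ 2 := by gcongr
      rw [closedLoop]
      push_cast
      linarith
  have h1 := hdec T le_rfl
  have h2 := M.cost_nonneg hR hP (M.closedLoop x w T) (M.optimizer (M.closedLoop x w T))
  rw [valueFunction] at h1
  linarith

end StripedMPC

/-! ### Runs in independent sequences -/

/-- In an i.i.d. sequence, runs of any given length in a set of positive probability occur almost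
surely: apply the second Borel–Cantelli lemma to disjoint blocks. -/
theorem ae_exists_run {Ω β : Type*} [MeasurableSpace Ω] {μ : Measure Ω} [IsProbabilityMeasure μ]
    [MeasurableSpace β] {w : ℕ → Ω → β} (hwm : ∀ k, Measurable (w k)) (hwi : iIndepFun w μ)
    (hwd : ∀ k, IdentDistrib (w k) (w 0) μ μ) {s : Set β} (hs : MeasurableSet s)
    (hpos : μ (w 0 ⁻¹' s) ≠ 0) (T : ℕ) : ∀ᵐ ω ∂μ, ∃ k, ∀ i < T, w (k + i) ω ∈ s := by
  have hinj : Function.Injective fun p : ℕ × Fin T => p.1 * T + (p.2 : ℕ) := by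
    rintro ⟨a, i⟩ ⟨b, j⟩ h
    have hT : 0 < T := i.pos
    simp only at h
    have h1 := congrArg (· / T) h
    have h2 := congrArg (· % T) h
    simp only [Nat.mul_add_mod_of_lt i.2, Nat.mul_add_mod_of_lt j.2] at h2
    simp only [Nat.add_comm, Nat.add_mul_div_right _ _ hT, Nat.div_eq_of_lt i.2,
      Nat.div_eq_of_lt j.2, zero_add] at h1
    exact Prod.ext h1 (Fin.ext h2)
  have hv := hwi.precomp hinj
  -- the event that the `k`-th block of length `T` stays in `s`
  let E : ℕ → Set Ω := fun k => ⋂ i : Fin T, w (k * T + i) ⁻¹' s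
  have hEm : ∀ k, MeasurableSet (E k) := fun k => MeasurableSet.iInter fun i => hwm _ hs
  have hprod : ∀ S : Finset ℕ, μ (⋂ k ∈ S, E k) = ∏ _k ∈ S, μ (w 0 ⁻¹' s) ^ T := by
    intro S
    have h := hv.measure_inter_preimage_eq_mul (S ×ˢ Finset.univ) (sets := fun _ => s)
      fun _ _ => hs
    have hset : ⋂ k ∈ S, E k = ⋂ p ∈ S ×ˢ (Finset.univ : Finset (Fin T)),
        w (p.1 * T + (p.2 : ℕ)) ⁻¹' s := by
      ext ω
      simp only [E, Set.mem_iInter, Finset.mem_product, Finset.mem_univ, and_true, Prod.forall]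
      exact ⟨fun h a i ha => h a ha i, fun h a ha i => h a i ha⟩
    rw [hset]
    refine h.trans ?_
    rw [Finset.prod_product]
    refine Finset.prod_congr rfl fun k _ => ?_
    have hid : ∀ i : Fin T, μ (w (k * T + i) ⁻¹' s) = μ (w 0 ⁻¹' s) := fun i =>
      (hwd _).measure_mem_eq hs
    simp [hid]
  have hE : ∀ k, μ (E k) = μ (w 0 ⁻¹' s) ^ T := fun k => by simpa using hprod {k}
  have hindep : iIndepSet E μ := (iIndepSet_iff_meas_biInter hEm).2 fun S => by
    rw [hprod]
    exact Finset.prod_congr rfl fun k _ => (hE k).symm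
  have hlim := measure_limsup_eq_one hEm hindep (by
    simp only [hE]
    exact ENNReal.tsum_const_eq_top_of_ne_zero (pow_ne_zero _ hpos))
  have hae := (prob_compl_eq_zero_iff (MeasurableSet.measurableSet_limsup hEm)).2 hlim
  filter_upwards [measure_eq_zero_iff_ae_notMem.1 hae] with ω hω
  rw [Set.notMem_compl_iff, mem_limsup_iff_frequently_mem] at hω
  obtain ⟨k, hk⟩ := hω.exists
  exact ⟨k * T, fun i hi => Set.mem_iInter.1 hk ⟨i, hi⟩⟩

/-! ### Second moments along a stochastic recursion -/

/-- The states of a recursion `x (k + 1) = f (x k) (w k)` depend measurably on the finitely many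
past disturbances. -/
theorem exists_measurable_eq_of_recursion {E F Ω : Type*} [MeasurableSpace E] [MeasurableSpace F]
    {f : E → F → E} (hf : Measurable (Function.uncurry f)) {w : ℕ → Ω → F} {x : ℕ → Ω → E}
    {x₀ : E} (hx₀ : ∀ ω, x 0 ω = x₀) (hx : ∀ k ω, x (k + 1) ω = f (x k ω) (w k ω)) (k : ℕ) :
    ∃ G : ((i : Finset.range k) → F) → E, Measurable G ∧ x k = fun ω => G fun i => w i ω := by
  induction k with
  | zero => exact ⟨fun _ => x₀, measurable_const, funext hx₀⟩
  | succ k ih =>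
    obtain ⟨G, hG, hxG⟩ := ih
    refine ⟨fun z => f (G fun i => z ⟨i, Finset.mem_range.2
      ((Finset.mem_range.1 i.2).trans (Nat.lt_succ_self k))⟩) (z ⟨k, Finset.self_mem_range_succ k⟩),
      ?_, ?_⟩
    · exact hf.comp ((hG.comp (measurable_pi_lambda _ fun i => measurable_pi_apply _)).prodMk
        (measurable_pi_apply _))
    · funext ω
      rw [hx, hxG]

theorem measurable_of_recursion {E F Ω : Type*} [MeasurableSpace Ω] [MeasurableSpace E]
    [MeasurableSpace F] {f : E → F → E} (hf : Measurable (Function.uncurry f)) {w : ℕ → Ω → F}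
    (hwm : ∀ k, Measurable (w k)) {x : ℕ → Ω → E} {x₀ : E} (hx₀ : ∀ ω, x 0 ω = x₀)
    (hx : ∀ k ω, x (k + 1) ω = f (x k ω) (w k ω)) (k : ℕ) : Measurable (x k) := by
  obtain ⟨G, hG, hxG⟩ := exists_measurable_eq_of_recursion hf hx₀ hx k
  rw [hxG]
  exact hG.comp (measurable_pi_lambda _ fun i => hwm i)

theorem indepFun_of_recursion {E F Ω : Type*} [MeasurableSpace Ω] {μ : Measure Ω}
    [MeasurableSpace E] [MeasurableSpace F] {f : E → F → E}
    (hf : Measurable (Function.uncurry f)) {w : ℕ → Ω → F} (hwm : ∀ k, Measurable (w k))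
    (hwi : iIndepFun w μ) {x : ℕ → Ω → E} {x₀ : E} (hx₀ : ∀ ω, x 0 ω = x₀)
    (hx : ∀ k ω, x (k + 1) ω = f (x k ω) (w k ω)) (k : ℕ) : IndepFun (x k) (w k) μ := by
  obtain ⟨G, hG, hxG⟩ := exists_measurable_eq_of_recursion hf hx₀ hx k
  have h := hwi.indepFun_finset (Finset.range k) {k} (by simp) hwm
  rw [hxG]
  exact h.comp hG (measurable_pi_apply (⟨k, Finset.mem_singleton_self k⟩ : ({k} : Finset ℕ)))

theorem integrable_continuous_comp_of_bounded {E Ω : Type*} [MeasurableSpace Ω] {μ : Measure Ω}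
    [IsFiniteMeasure μ] [NormedAddCommGroup E] [ProperSpace E] [MeasurableSpace E] [BorelSpace E]
    {f : E → ℝ} (hf : Continuous f) {ξ : Ω → E} (hξ : Measurable ξ)
    (hb : ∃ C, ∀ᵐ ω ∂μ, ‖ξ ω‖ ≤ C) : Integrable (fun ω => f (ξ ω)) μ := by
  obtain ⟨C, hC⟩ := hb
  obtain ⟨C', hC'⟩ := (isCompact_closedBall (0 : E) C).exists_bound_of_continuousOn hf.continuousOn
  refine Integrable.of_bound (hf.measurable.comp hξ).aestronglyMeasurable C' ?_
  filter_upwards [hC] with ω hω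
  exact hC' _ (mem_closedBall_zero_iff.2 hω)

/-- An independent disturbance of mean zero is uncorrelated with `ξ`, so the second moments of the
two add. -/
theorem integral_quadratic_add_mulVec {n q : ℕ} {Ω : Type*} [MeasurableSpace Ω] {μ : Measure Ω}
    [IsProbabilityMeasure μ] {P : Matrix (Fin n) (Fin n) ℝ} (hP : P.IsSymm)
    (D : Matrix (Fin n) (Fin q) ℝ) {ξ : Ω → Fin n → ℝ} {w : Ω → Fin q → ℝ} (hξ : Measurable ξ)
    (hw : Measurable w) (hind : IndepFun ξ w μ) (hξb : ∃ C, ∀ᵐ ω ∂μ, ‖ξ ω‖ ≤ C)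
    (hwb : ∃ C, ∀ᵐ ω ∂μ, ‖w ω‖ ≤ C) (hw0 : ∫ ω, w ω ∂μ = 0) :
    ∫ ω, (ξ ω + D *ᵥ w ω) ⬝ᵥ P *ᵥ (ξ ω + D *ᵥ w ω) ∂μ =
      ∫ ω, ξ ω ⬝ᵥ P *ᵥ ξ ω ∂μ + ∫ ω, w ω ⬝ᵥ (Dᵀ * P * D) *ᵥ w ω ∂μ := by
  have hwint : Integrable w μ := by
    obtain ⟨C, hC⟩ := hwb
    exact Integrable.of_bound hw.aestronglyMeasurable C hC
  have hξi : ∀ i, Integrable (fun ω => ξ ω i) μ := fun i =>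
    integrable_continuous_comp_of_bounded (continuous_apply i) hξ hξb
  let ℓ : Fin n → (Fin q → ℝ) →L[ℝ] ℝ := fun i =>
    LinearMap.toContinuousLinearMap ((LinearMap.proj i).comp (Matrix.toLin' (P * D)))
  have hℓ : ∀ i v, ℓ i v = (P *ᵥ (D *ᵥ v)) i := by
    intro i v
    rw [Matrix.mulVec_mulVec]
    rfl
  have hwi : ∀ i, Integrable (fun ω => ℓ i (w ω)) μ := fun i => (ℓ i).integrable_comp hwint
  have hmean : ∀ i, ∫ ω, ℓ i (w ω) ∂μ = 0 := fun i => by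
    rw [(ℓ i).integral_comp_comm hwint, hw0, map_zero]
  have hindi : ∀ i, IndepFun (fun ω => ξ ω i) (fun ω => ℓ i (w ω)) μ := fun i =>
    hind.comp (measurable_pi_apply i) (ℓ i).continuous.measurable
  have hci : ∀ i, Integrable (fun ω => ξ ω i * ℓ i (w ω)) μ := fun i =>
    (hindi i).integrable_mul (hξi i) (hwi i)
  have hcross_eq : ∀ ω, ξ ω ⬝ᵥ P *ᵥ (D *ᵥ w ω) = ∑ i, ξ ω i * ℓ i (w ω) := fun ω => by
    simp only [hℓ, dotProduct]
  have hcross : ∫ ω, ξ ω ⬝ᵥ P *ᵥ (D *ᵥ w ω) ∂μ = 0 := by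
    simp only [hcross_eq]
    rw [integral_finsetSum _ fun i _ => hci i]
    refine Finset.sum_eq_zero fun i _ => ?_
    rw [(hindi i).integral_fun_mul_eq_mul_integral (hξi i).aestronglyMeasurable
      (hwi i).aestronglyMeasurable, hmean, mul_zero]
  have hcross_int : Integrable (fun ω => ξ ω ⬝ᵥ P *ᵥ (D *ᵥ w ω)) μ := by
    simp only [hcross_eq]
    exact integrable_finsetSum _ fun i _ => hci i
  have hξP := integrable_continuous_comp_of_bounded (continuous_quadratic P) hξ hξb
  have hwP := integrable_continuous_comp_of_bounded (continuous_quadratic (Dᵀ * P * D)) hw hwb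
  simp only [hP.dotProduct_mulVec_add, mulVec_dotProduct_mulVec_mulVec]
  have hξcross : Integrable (fun ω => ξ ω ⬝ᵥ P *ᵥ ξ ω + 2 * (ξ ω ⬝ᵥ P *ᵥ (D *ᵥ w ω))) μ :=
    hξP.add (hcross_int.const_mul 2)
  rw [integral_add hξcross hwP, integral_add hξP (hcross_int.const_mul 2), integral_const_mul,
    hcross, mul_zero, add_zero]

/-! ### Averages -/

/-- Telescoping: if `b` differs from `l` by a null sequence and the increments of a bounded
sequence, then its averages tend to `l`. -/
theorem tendsto_average_of_telescoping {a b e : ℕ → ℝ} {l C : ℝ} (ha : ∀ k, |a k| ≤ C)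
    (he : Tendsto e atTop (𝓝 0)) (hb : ∀ k, b k = l + e k + (a k - a (k + 1))) :
    Tendsto (fun k : ℕ => (1 / (k : ℝ)) * ∑ j ∈ Finset.range k, b j) atTop (𝓝 l) := by
  have h1 : Tendsto (fun k : ℕ => (k : ℝ)⁻¹ * ∑ j ∈ Finset.range k, (l + e j)) atTop (𝓝 l) := by
    simpa using (he.const_add l).cesaro
  have h2 : Tendsto (fun k : ℕ => (k : ℝ)⁻¹ * (a 0 - a k)) atTop (𝓝 0) := by
    refine tendsto_inv_atTop_nhds_zero_nat.zero_mul_isBoundedUnder_le ?_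
    refine isBoundedUnder_of ⟨C + C, fun k => ?_⟩
    exact (abs_sub _ _).trans (add_le_add (ha 0) (ha k))
  have h3 := h1.add h2
  rw [add_zero] at h3
  refine h3.congr fun k => ?_
  simp only [hb]
  rw [Finset.sum_add_distrib (f := fun j => l + e j), Finset.sum_range_sub', one_div, mul_add]

/-- A nonnegative sequence with `a (k + 1) = a k - b k + l` whose decrements `b` dominate a
multiple of `a` is bounded. -/
theorem exists_bound_of_contraction {a b : ℕ → ℝ} {l ε : ℝ} (hε : 0 < ε) (hε1 : ε ≤ 1)
    (hb : ∀ k, ε * a k ≤ b k) (h : ∀ k, a (k + 1) = a k - b k + l) :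
    ∃ C, ∀ k, a k ≤ C := by
  refine ⟨max (a 0) (l / ε), fun k => ?_⟩
  induction k with
  | zero => exact le_max_left _ _
  | succ k ih =>
    have h1 : l ≤ ε * max (a 0) (l / ε) := by
      rw [← div_le_iff₀' hε]
      exact le_max_right _ _
    have h2 := mul_le_mul_of_nonneg_left ih (sub_nonneg.2 hε1)
    have h3 := hb k
    rw [h k]
    linarith

namespace StripedMPC

theorem integral_quadratic_eq_lss {n m q nc : ℕ} (M : StripedMPC n m q nc) {Ω : Type*}
    [MeasurableSpace Ω] {μ : Measure Ω} {w : ℕ → Ω → Fin q → ℝ}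
    (hwd : ∀ k, IdentDistrib (w k) (w 0) μ μ) (k : ℕ) :
    ∫ ω, w k ω ⬝ᵥ (M.Dᵀ * M.P * M.D) *ᵥ w k ω ∂μ = M.lss μ (w 0) :=
  ((hwd k).comp (continuous_quadratic _).measurable).integral_eq

/-! ### The unconstrained loop -/

theorem exists_ae_bound_unconstrainedLoop {n m q nc : ℕ} (M : StripedMPC n m q nc) {Ω : Type*}
    [MeasurableSpace Ω] {μ : Measure Ω} {w : ℕ → Ω → Fin q → ℝ}
    (hwb : ∀ k, ∃ C, ∀ᵐ ω ∂μ, ‖w k ω‖ ≤ C) (y₀ : Fin n → ℝ) (k : ℕ) :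
    ∃ C, ∀ᵐ ω ∂μ, ‖M.unconstrainedLoop y₀ (fun i => w i ω) k‖ ≤ C := by
  induction k with
  | zero => exact ⟨‖y₀‖, ae_of_all _ fun _ => le_rfl⟩
  | succ k ih =>
    obtain ⟨C₁, h₁⟩ := ih
    obtain ⟨C₂, h₂⟩ := hwb k
    have hcont : Continuous fun z : (Fin n → ℝ) × (Fin q → ℝ) => M.Φ *ᵥ z.1 + M.D *ᵥ z.2 := by
      fun_prop
    obtain ⟨C, hC⟩ := ((isCompact_closedBall (0 : Fin n → ℝ) C₁).prod
      (isCompact_closedBall (0 : Fin q → ℝ) C₂)).exists_bound_of_continuousOn hcont.continuousOn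
    refine ⟨C, ?_⟩
    filter_upwards [h₁, h₂] with ω hω₁ hω₂
    exact hC (_, _) ⟨mem_closedBall_zero_iff.2 hω₁, mem_closedBall_zero_iff.2 hω₂⟩

/-- The stage cost dominates a multiple of the value, so the second moments of the unconstrained
loop stay bounded, and its average cost follows by telescoping. -/
theorem tendsto_average_unconstrainedLoop {n m q nc : ℕ} (M : StripedMPC n m q nc)
    (hQ : M.Q.PosDef) (hR : M.R.PosDef) (hP : M.P.PosDef) (hRic : M.SolvesRiccati)
    {Ω : Type*} [MeasurableSpace Ω] {μ : Measure Ω} [IsProbabilityMeasure μ]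
    {w : ℕ → Ω → Fin q → ℝ} (hwm : ∀ k, Measurable (w k)) (hwi : iIndepFun w μ)
    (hwd : ∀ k, IdentDistrib (w k) (w 0) μ μ) (hwz : ∀ k, ∫ ω, w k ω ∂μ = 0)
    (hwb : ∀ k, ∃ C, ∀ᵐ ω ∂μ, ‖w k ω‖ ≤ C) (y₀ : Fin n → ℝ) :
    Tendsto (fun k : ℕ => (1 / (k : ℝ)) * ∑ j ∈ Finset.range k,
        ∫ ω, M.unconstrainedLoop y₀ (fun i => w i ω) j ⬝ᵥ
          M.S *ᵥ M.unconstrainedLoop y₀ (fun i => w i ω) j ∂μ)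
      atTop (𝓝 (M.lss μ (w 0))) := by
  set y : ℕ → Ω → Fin n → ℝ := fun k ω => M.unconstrainedLoop y₀ (fun i => w i ω) k
  have hf : Measurable (Function.uncurry fun (x : Fin n → ℝ) (v : Fin q → ℝ) =>
      M.Φ *ᵥ x + M.D *ᵥ v) := by
    refine Continuous.measurable ?_
    unfold Function.uncurry
    fun_prop
  have hym := measurable_of_recursion hf hwm (x := y) (fun _ => rfl) (fun _ _ => rfl)
  have hyi := indepFun_of_recursion hf hwm hwi (x := y) (fun _ => rfl) (fun _ _ => rfl)
  have hyb := M.exists_ae_bound_unconstrainedLoop hwb y₀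
  have hΦ : Continuous fun x : Fin n → ℝ => M.Φ *ᵥ x := by fun_prop
  have hPint := fun k =>
    integrable_continuous_comp_of_bounded (continuous_quadratic M.P) (hym k) (hyb k)
  have hSint := fun k =>
    integrable_continuous_comp_of_bounded (continuous_quadratic M.S) (hym k) (hyb k)
  have hstep : ∀ k, ∫ ω, y (k + 1) ω ⬝ᵥ M.P *ᵥ y (k + 1) ω ∂μ =
      ∫ ω, y k ω ⬝ᵥ M.P *ᵥ y k ω ∂μ - ∫ ω, y k ω ⬝ᵥ M.S *ᵥ y k ω ∂μ + M.lss μ (w 0) := by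
    intro k
    have hΦb : ∃ C, ∀ᵐ ω ∂μ, ‖M.Φ *ᵥ y k ω‖ ≤ C := by
      obtain ⟨C, hC⟩ := hyb k
      obtain ⟨C', hC'⟩ :=
        (isCompact_closedBall (0 : Fin n → ℝ) C).exists_bound_of_continuousOn hΦ.continuousOn
      refine ⟨C', ?_⟩
      filter_upwards [hC] with ω hω
      exact hC' _ (mem_closedBall_zero_iff.2 hω)
    have h := integral_quadratic_add_mulVec hP.isSymm M.D (hΦ.measurable.comp (hym k)) (hwm k)
      ((hyi k).comp hΦ.measurable measurable_id) hΦb (hwb k) (hwz k)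
    simp only [Function.comp_apply, M.quadratic_P_Φ hR hP hRic] at h
    rw [integral_sub (hPint k) (hSint k), M.integral_quadratic_eq_lss hwd] at h
    exact h
  obtain ⟨s, hs, hSs⟩ := (M.S_posDef hQ hR).exists_le_quadratic
  obtain ⟨C, hC, hPC⟩ := exists_quadratic_le M.P
  have hSP : ∀ x : Fin n → ℝ, min (s / C) 1 * (x ⬝ᵥ M.P *ᵥ x) ≤ x ⬝ᵥ M.S *ᵥ x := fun x =>
    calc min (s / C) 1 * (x ⬝ᵥ M.P *ᵥ x) ≤ s / C * (x ⬝ᵥ M.P *ᵥ x) :=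
          mul_le_mul_of_nonneg_right (min_le_left _ _) (hP.quadratic_nonneg x)
      _ ≤ s / C * (C * ‖x‖ ^ 2) := mul_le_mul_of_nonneg_left (hPC x) (by positivity)
      _ = s * ‖x‖ ^ 2 := by field_simp
      _ ≤ _ := hSs x
  obtain ⟨C', hC'⟩ := exists_bound_of_contraction
    (a := fun k => ∫ ω, y k ω ⬝ᵥ M.P *ᵥ y k ω ∂μ) (b := fun k => ∫ ω, y k ω ⬝ᵥ M.S *ᵥ y k ω ∂μ)
    (ε := min (s / C) 1) (by positivity) (min_le_right _ _)
    (fun k => by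
      rw [← integral_const_mul]
      exact integral_mono ((hPint k).const_mul _) (hSint k) fun ω => hSP _) hstep
  refine tendsto_average_of_telescoping (a := fun k => ∫ ω, y k ω ⬝ᵥ M.P *ᵥ y k ω ∂μ) (e := 0)
    (C := C') (fun k => ?_) tendsto_const_nhds fun k => ?_
  · rw [abs_of_nonneg (integral_nonneg fun ω => hP.quadratic_nonneg _)]
    exact hC' k
  · have := hstep k
    simp only [Pi.zero_apply]
    linarith

/-! ### The closed loop -/

theorem ae_eventually_closedLoop_mem_minRPI {n m q nc : ℕ} (M : StripedMPC n m q nc)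
    (hQ : M.Q.PosDef) (hR : M.R.PosDef) (hP : M.P.PosDef) (hRic : M.SolvesRiccati)
    (hN₂ : M.HorizonLongEnough) (hF : IsCompact M.feasiblePairs)
    (hnhds : M.minRPI ∈ 𝓝 (0 : Fin n → ℝ)) {Ω : Type*} [MeasurableSpace Ω] {μ : Measure Ω}
    [IsProbabilityMeasure μ] {w : ℕ → Ω → Fin q → ℝ} (hwm : ∀ k, Measurable (w k))
    (hwi : iIndepFun w μ) (hwd : ∀ k, IdentDistrib (w k) (w 0) μ μ)
    (hwW : ∀ᵐ ω ∂μ, ∀ k, w k ω ∈ M.W) (hws : ∀ r : ℝ, 0 < r → 0 < μ {ω | ‖w 0 ω‖ ≤ r})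
    {x₀ : Fin n → ℝ} (hx₀ : x₀ ∈ M.feasibleStates) :
    ∀ᵐ ω ∂μ, ∀ᶠ k in atTop, M.closedLoop x₀ (fun i => w i ω) k ∈ M.minRPI := by
  obtain ⟨r, hr, T, hT⟩ := M.exists_closedLoop_mem_minRPI hQ hR hP hRic hN₂ hF hnhds
  have hrun := ae_exists_run hwm hwi hwd (s := {v | ‖v‖ ≤ r})
    (isClosed_le continuous_norm continuous_const).measurableSet (hws r hr).ne' T
  filter_upwards [hrun, hwW] with ω ⟨k, hk⟩ hω
  have hX := M.closedLoop_mem_of_isRPI (M.isRPI_feasibleStates hN₂ hF) hx₀ hω k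
  obtain ⟨j, hj⟩ := hT _ hX (fun i => w (k + i) ω) (fun i => hω _) hk
  rw [← closedLoop_add] at hj
  refine eventually_atTop.2 ⟨k + j, fun i hi => ?_⟩
  obtain ⟨d, rfl⟩ := Nat.exists_eq_add_of_le hi
  rw [closedLoop_add]
  exact M.closedLoop_mem_of_isRPI M.isRPI_minRPI hj (fun i => hω _) d

/-- The nominal successor state `Φ x + B c⋆₀(x)` of the closed loop. -/
noncomputable def nominalSuccessor {n m q nc : ℕ} (M : StripedMPC n m q nc) (x : Fin n → ℝ) :
    Fin n → ℝ :=
  M.Φ *ᵥ x + M.B *ᵥ M.perturbation (M.optimizer x) 0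

theorem measurable_nominalSuccessor {n m q nc : ℕ} (M : StripedMPC n m q nc)
    (hopt : Measurable M.optimizer) : Measurable M.nominalSuccessor := by
  have h := M.measurable_perturbation_optimizer hopt
  have hcont : Continuous fun z : (Fin n → ℝ) × (Fin m → ℝ) => M.Φ *ᵥ z.1 + M.B *ᵥ z.2 := by
    fun_prop
  exact hcont.measurable.comp (measurable_id.prodMk h)

theorem measurable_closedLoopMap {n m q nc : ℕ} (M : StripedMPC n m q nc)
    (hopt : Measurable M.optimizer) : Measurable (Function.uncurry M.closedLoopMap) := by
  have hcont : Continuous fun z : (Fin n → ℝ) × (Fin q → ℝ) => z.1 + M.D *ᵥ z.2 := by fun_prop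
  exact hcont.measurable.comp
    (((M.measurable_nominalSuccessor hopt).comp measurable_fst).prodMk measurable_snd)

theorem exists_bound_nominalSuccessor {n m q nc : ℕ} (M : StripedMPC n m q nc)
    (hF : IsCompact M.feasiblePairs) :
    ∃ C, ∀ x ∈ M.feasibleStates, ‖M.nominalSuccessor x‖ ≤ C := by
  have hcont : Continuous fun z : (Fin n → ℝ) × (Fin M.N → Fin m → ℝ) =>
      M.Φ *ᵥ z.1 + M.B *ᵥ M.perturbation z.2 0 := by
    unfold perturbation
    split_ifs <;> fun_prop
  obtain ⟨C, hC⟩ := hF.exists_bound_of_continuousOn hcont.continuousOn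
  exact ⟨C, fun x hx => hC (x, M.optimizer x) (M.isOptimal_optimizer hF hx).1⟩

/-- The expected value `xᵀ P x` changes per step by `l_ss` minus the stage cost, up to a term that
vanishes once the state is in the region where `c⋆₀ = 0`. That term is bounded, so its expectation
tends to zero by dominated convergence, and the average cost follows by telescoping. -/
theorem tendsto_average_closedLoop {n m q nc : ℕ} (M : StripedMPC n m q nc)
    (hR : M.R.PosDef) (hP : M.P.PosDef) (hRic : M.SolvesRiccati) (hF : IsCompact M.feasiblePairs)
    (hopt : Measurable M.optimizer) (huc : M.minRPI ⊆ M.unconstrainedRegion)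
    {Ω : Type*} [MeasurableSpace Ω] {μ : Measure Ω} [IsProbabilityMeasure μ]
    {w : ℕ → Ω → Fin q → ℝ} (hwm : ∀ k, Measurable (w k)) (hwi : iIndepFun w μ)
    (hwd : ∀ k, IdentDistrib (w k) (w 0) μ μ) (hwz : ∀ k, ∫ ω, w k ω ∂μ = 0)
    (hwb : ∀ k, ∃ C, ∀ᵐ ω ∂μ, ‖w k ω‖ ≤ C) {x₀ : Fin n → ℝ}
    (hX : ∀ᵐ ω ∂μ, ∀ k, M.closedLoop x₀ (fun i => w i ω) k ∈ M.feasibleStates)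
    (hlim : ∀ᵐ ω ∂μ, ∀ᶠ k in atTop, M.closedLoop x₀ (fun i => w i ω) k ∈ M.minRPI) :
    (∀ j, Integrable (fun ω => M.closedLoop x₀ (fun i => w i ω) j ⬝ᵥ
      M.S *ᵥ M.closedLoop x₀ (fun i => w i ω) j) μ) ∧
    Tendsto (fun k : ℕ => (1 / (k : ℝ)) * ∑ j ∈ Finset.range k,
        ∫ ω, M.closedLoop x₀ (fun i => w i ω) j ⬝ᵥ
          M.S *ᵥ M.closedLoop x₀ (fun i => w i ω) j ∂μ)
      atTop (𝓝 (M.lss μ (w 0))) := by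
  set x : ℕ → Ω → Fin n → ℝ := fun k ω => M.closedLoop x₀ (fun i => w i ω) k
  have hf := M.measurable_closedLoopMap hopt
  have hφ := M.measurable_nominalSuccessor hopt
  have hxm := measurable_of_recursion hf hwm (x := x) (fun _ => rfl) (fun _ _ => rfl)
  have hxi := indepFun_of_recursion hf hwm hwi (x := x) (fun _ => rfl) (fun _ _ => rfl)
  have hXc : IsCompact M.feasibleStates := by
    rw [feasibleStates_eq_image]
    exact hF.image continuous_fst
  obtain ⟨Cx, hCx⟩ := hXc.exists_bound_of_continuousOn continuous_id.continuousOn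
  obtain ⟨Cφ, hCφ⟩ := M.exists_bound_nominalSuccessor hF
  have hxb : ∀ k, ∃ C, ∀ᵐ ω ∂μ, ‖x k ω‖ ≤ C := fun k => ⟨Cx, hX.mono fun ω h => hCx _ (h k)⟩
  have hφb : ∀ k, ∃ C, ∀ᵐ ω ∂μ, ‖M.nominalSuccessor (x k ω)‖ ≤ C := fun k =>
    ⟨Cφ, hX.mono fun ω h => hCφ _ (h k)⟩
  have hPint := fun k =>
    integrable_continuous_comp_of_bounded (continuous_quadratic M.P) (hxm k) (hxb k)
  have hSint := fun k =>
    integrable_continuous_comp_of_bounded (continuous_quadratic M.S) (hxm k) (hxb k)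
  have hφint := fun k => integrable_continuous_comp_of_bounded (continuous_quadratic M.P)
    (hφ.comp (hxm k)) (hφb k)
  refine ⟨hSint, ?_⟩
  -- the excess of the value at the nominal successor over that under the unconstrained law
  let d : (Fin n → ℝ) → ℝ := fun z => M.nominalSuccessor z ⬝ᵥ M.P *ᵥ M.nominalSuccessor z -
    (z ⬝ᵥ M.P *ᵥ z - z ⬝ᵥ M.S *ᵥ z)
  have hd0 : ∀ z ∈ M.unconstrainedRegion, d z = 0 := by
    intro z hz
    have : M.nominalSuccessor z = M.Φ *ᵥ z := by
      rw [nominalSuccessor, hz.2, Matrix.mulVec_zero, add_zero]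
    simp only [d, this, M.quadratic_P_Φ hR hP hRic, sub_self]
  have hdm : Measurable d :=
    ((continuous_quadratic M.P).measurable.comp hφ).sub
      ((continuous_quadratic M.P).measurable.sub (continuous_quadratic M.S).measurable)
  obtain ⟨Cd, hCd⟩ : ∃ C, ∀ z ∈ M.feasibleStates, ‖d z‖ ≤ C := by
    obtain ⟨C₁, h₁⟩ := (isCompact_closedBall (0 : Fin n → ℝ) Cφ).exists_bound_of_continuousOn
      (continuous_quadratic M.P).continuousOn
    obtain ⟨C₂, h₂⟩ := hXc.exists_bound_of_continuousOn
      ((continuous_quadratic M.P).sub (continuous_quadratic M.S)).continuousOn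
    exact ⟨C₁ + C₂, fun z hz => (norm_sub_le _ _).trans
      (add_le_add (h₁ _ (mem_closedBall_zero_iff.2 (hCφ z hz))) (h₂ z hz))⟩
  have hdlim : Tendsto (fun k => ∫ ω, d (x k ω) ∂μ) atTop (𝓝 0) := by
    have h := tendsto_integral_of_dominated_convergence (F := fun k ω => d (x k ω))
      (f := fun _ => (0 : ℝ)) (μ := μ) (fun _ => Cd)
      (fun k => (hdm.comp (hxm k)).aestronglyMeasurable) (integrable_const Cd)
      (fun k => hX.mono fun ω h => hCd _ (h k))
      (hlim.mono fun ω h => tendsto_const_nhds.congr' (h.mono fun k hk => (hd0 _ (huc hk)).symm))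
    simpa using h
  have hstep : ∀ k, ∫ ω, x (k + 1) ω ⬝ᵥ M.P *ᵥ x (k + 1) ω ∂μ =
      ∫ ω, M.nominalSuccessor (x k ω) ⬝ᵥ M.P *ᵥ M.nominalSuccessor (x k ω) ∂μ +
        M.lss μ (w 0) := by
    intro k
    have h := integral_quadratic_add_mulVec hP.isSymm M.D (hφ.comp (hxm k)) (hwm k)
      ((hxi k).comp hφ measurable_id) (hφb k) (hwb k) (hwz k)
    rw [M.integral_quadratic_eq_lss hwd] at h
    exact h
  have hdint : ∀ k, ∫ ω, d (x k ω) ∂μ =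
      ∫ ω, M.nominalSuccessor (x k ω) ⬝ᵥ M.P *ᵥ M.nominalSuccessor (x k ω) ∂μ -
        (∫ ω, x k ω ⬝ᵥ M.P *ᵥ x k ω ∂μ - ∫ ω, x k ω ⬝ᵥ M.S *ᵥ x k ω ∂μ) := fun k =>
    (integral_sub (hφint k) ((hPint k).sub (hSint k))).trans
      (congrArg _ (integral_sub (hPint k) (hSint k)))
  obtain ⟨C, hC⟩ := hXc.exists_bound_of_continuousOn (continuous_quadratic M.P).continuousOn
  refine tendsto_average_of_telescoping (a := fun k => ∫ ω, x k ω ⬝ᵥ M.P *ᵥ x k ω ∂μ)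
    (e := fun k => ∫ ω, d (x k ω) ∂μ) (C := C) (fun k => ?_) hdlim fun k => ?_
  · simpa using norm_integral_le_of_norm_le_const (hX.mono fun ω h => hC _ (h k))
  · have h1 := hstep k
    have h2 := hdint k
    linarith

end StripedMPC

theorem mainTheorem5 {n m q nc : ℕ} (M : StripedMPC n m q nc)
    -- weights and Riccati equation
    (hQ : M.Q.PosDef) (hR : M.R.PosDef) (hP : M.P.PosDef) (hRic : M.SolvesRiccati)
    -- hard constraints
    (hZ : IsPolyhedron M.Z) (hZc : IsCompact M.Z) (hZ0 : (0 : (Fin n → ℝ) × (Fin m → ℝ)) ∈ interior M.Z)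
    -- disturbance set and horizons
    (hWb : Bornology.IsBounded M.W) (hW0 : (0 : Fin q → ℝ) ∈ interior M.W)
    (hN : 1 ≤ M.N) (hN₂ : M.HorizonLongEnough)
    -- disturbance process: i.i.d., zero mean, supported in `W`, small values have positive probability
    {Ω : Type*} [MeasurableSpace Ω] (μ : Measure Ω) [IsProbabilityMeasure μ]
    (w : ℕ → Ω → Fin q → ℝ) (hwm : ∀ k, Measurable (w k))
    (hwi : iIndepFun w μ) (hwd : ∀ k, IdentDistrib (w k) (w 0) μ μ)
    (hwz : ∀ k, ∫ ω, w k ω ∂μ = 0) (hwW : ∀ k, ∀ᵐ ω ∂μ, w k ω ∈ M.W)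
    (hws : ∀ r : ℝ, 0 < r → ∀ k, 0 < μ {ω | ‖w k ω‖ ≤ r})
    -- probabilistic constraints: the tightened ones ensure the original ones
    (hp : ∀ j, 0 < M.p j ∧ M.p j ≤ 1)
    (hγ : ∀ j x u, M.f j ⬝ᵥ (M.A *ᵥ x + M.B *ᵥ u) + M.g j ⬝ᵥ u + M.γ j ≤ M.h j →
      M.p j ≤ μ.real {ω | M.f j ⬝ᵥ (M.A *ᵥ x + M.B *ᵥ u + M.D *ᵥ w 0 ω) + M.g j ⬝ᵥ u ≤ M.h j})
    -- non-degeneracy of the minimal RPI set, and its inclusion in the region where `c⋆₀ = 0`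
    (hctrl : IsControllablePair M.Φ M.D) (huc : M.minRPI ⊆ M.unconstrainedRegion)
    (x₀ : Fin n → ℝ) (hx₀ : x₀ ∈ M.feasibleStates) :
    (∀ᵐ ω ∂μ, Tendsto
      (fun k => M.minRPI.indicator (fun _ => (1 : ℝ)) (M.closedLoop x₀ (fun i => w i ω) k))
      atTop (𝓝 1)) ∧
    M.P - M.Φᵀ * M.P * M.Φ = M.S ∧
    (∀ j, Integrable (fun ω => M.closedLoop x₀ (fun i => w i ω) j ⬝ᵥ
      M.S *ᵥ M.closedLoop x₀ (fun i => w i ω) j) μ) ∧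
    (∃ l : ℝ, l ≤ M.lss μ (w 0) ∧ Tendsto
      (fun k : ℕ => (1 / (k : ℝ)) * ∑ j ∈ Finset.range k,
        ∫ ω, M.closedLoop x₀ (fun i => w i ω) j ⬝ᵥ
          M.S *ᵥ M.closedLoop x₀ (fun i => w i ω) j ∂μ)
      atTop (𝓝 l)) ∧
    (∀ y₀ : Fin n → ℝ, Tendsto
      (fun k : ℕ => (1 / (k : ℝ)) * ∑ j ∈ Finset.range k,
        ∫ ω, M.unconstrainedLoop y₀ (fun i => w i ω) j ⬝ᵥ
          M.S *ᵥ M.unconstrainedLoop y₀ (fun i => w i ω) j ∂μ)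
      atTop (𝓝 (M.lss μ (w 0)))) := by
  have hW : (0 : Fin q → ℝ) ∈ M.W := interior_subset hW0
  have hF := M.isCompact_feasiblePairs hZc hW hN
  have hopt := M.measurable_optimizer hR hP hZ hF
  have hwW' : ∀ᵐ ω ∂μ, ∀ k, w k ω ∈ M.W := ae_all_iff.2 hwW
  have hwb : ∀ k, ∃ C, ∀ᵐ ω ∂μ, ‖w k ω‖ ≤ C := by
    obtain ⟨C, hC⟩ := hWb.exists_norm_le
    exact fun k => ⟨C, (hwW k).mono fun ω h => hC _ h⟩
  have hX : ∀ᵐ ω ∂μ, ∀ k, M.closedLoop x₀ (fun i => w i ω) k ∈ M.feasibleStates :=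
    hwW'.mono fun ω h =>
      M.closedLoop_mem_of_isRPI (M.isRPI_feasibleStates hN₂ hF) hx₀ h
  have hlim := M.ae_eventually_closedLoop_mem_minRPI hQ hR hP hRic hN₂ hF
    (M.minRPI_mem_nhds hW0 hctrl huc) hwm hwi hwd hwW' (fun r hr => hws r hr 0) hx₀
  obtain ⟨hint, havg⟩ := M.tendsto_average_closedLoop hR hP hRic hF hopt huc hwm hwi hwd hwz hwb
    hX hlim
  refine ⟨hlim.mono fun ω h => ?_, M.lyapunov hR hP hRic, hint, ⟨_, le_rfl, havg⟩,
    M.tendsto_average_unconstrainedLoop hQ hR hP hRic hwm hwi hwd hwz hwb⟩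
  exact tendsto_const_nhds.congr' (h.mono fun k hk => (Set.indicator_of_mem hk _).symm)
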